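/- Let $d\ge 1$ and $\kappa=(\kappa_1,\dots,\kappa_{d+1})$ with all $\kappa_i\ge 0$. Let $B^m$ denote the closed Euclidean unit ball of $\mathbb{R}^m$, and on $B^d$ consider the product weight $$W_\kappa^B(x)=\prod_{i=1}^d|x_i|^{2\kappa_i}\,(1-\|x\|^2)^{\kappa_{d+1}-1/2}$$ and the distance $d_B(x,y)=\arccos\bigl(\langle x,y\rangle+\sqrt{1-\|x\|^2}\sqrt{1-\|y\|^2}\bigr)$. For $f\in L^1(W_\kappa^B;B^d)$ and $x\in B^d$ let $$M_\kappa^Bf(x)=\sup_{0<\theta\le\pi}\frac{\int_{\{y\in B^d:\,d_B(x,y)\le\theta\}}|f(y)|W_\kappa^B(y)\,dy}{\int_{\{y\in B^d:\,d_B(x,y)\le\theta\}}W_\kappa^B(y)\,dy},\qquad \mathcal{M}_\kappa^Bf(x)=\sup_{0<\theta\le\pi}\frac{\int_{B^d}|f(y)|\,V_\kappa^B[\chi_{e(x,\theta)}](Y)\,W_\kappa^B(y)\,dy}{\int_{B^d}V_\kappa^B[\chi_{e(x,\theta)}](Y)\,W_\kappa^B(y)\,dy},$$ both with values in $[0,\infty]$.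 Here $Y=(y,\sqrt{1-\|y\|^2})$, $\chi_E$ is the indicator function of $E$, $$e(x,\theta)=\{(y,y_{d+1})\in B^{d+1}:\ \langle x,y\rangle+\sqrt{1-\|x\|^2}\,y_{d+1}\ge\cos\theta,\ y_{d+1}\ge 0\},$$ $V_\kappa^Bg(x,x_{d+1})=\frac12\bigl[V_\kappa g(x,x_{d+1})+V_\kappa g(x,-x_{d+1})\bigr]$, and $V_\kappa$ is the intertwining operator of $\mathbb{Z}_2^{d+1}$, $$V_\kappa g(x)=c_\kappa\int_{[-1,1]^{d+1}}g(x_1t_1,\dots,x_{d+1}t_{d+1})\prod_{i=1}^{d+1}(1+t_i)(1-t_i^2)^{\kappa_i-1}\,dt,$$ with $c_\kappa$ determined by $V_\kappa 1=1$; if $\kappa_i=0$, the normalized measure in $t_i$ is replaced by its weak limit as $\kappa_i\to0^+$, the unit mass at $t_i=1$. Then: (1) There is a constant $c$, depending only on $d$ and $\kappa$, such that for every $f\in L^1(W_\kappa^B;B^d)$ and every $x\in B^d$, $$\mathcal{M}_\kappa^Bf(x)\le c\sum_{\varepsilon\in\{1,-1\}^d}M_\kappa^Bf(x\varepsilon),\qquad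 x\varepsilon=(x_1\varepsilon_1,\dots,x_d\varepsilon_d).$$ (2) $W_\kappa^B$ is a doubling weight on $(B^d,d_B)$: there is a constant $C$, depending only on $d$ and $\kappa$, such that for all $x\in B^d$ and $\theta>0$, $$\int_{d_B(x,y)\le2\theta}W_\kappa^B(y)\,dy\le C\int_{d_B(x,y)\le\theta}W_\kappa^B(y)\,dy,$$ and these integrals are positive and finite. -/

import Mathlib

open MeasureTheory Set
open scoped ENNReal NNReal

namespace BallMax

noncomputable section

/-- The unnormalized density `(1 + t) (1 - t²) ^ (k - 1)` on `[-1, 1]`. -/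
def vDensity (k t : ℝ) : ℝ := (1 + t) * (1 - t ^ 2) ^ (k - 1)

/-- The one-dimensional probability measure of the intertwining operator of `ℤ₂`:
`c_k (1 + t) (1 - t²) ^ (k - 1) dt` on `[-1, 1]`, with `c_k` the normalization constant, if `k ≠ 0`;
for `k = 0` its weak limit as `k → 0+`, which is the unit mass at `1` (the measures
`c_k (1 - t²) ^ (k - 1) dt` tend to half the sum of the unit masses at `1` and `-1`, and the
factor `1 + t` takes the values `2` and `0` there). -/
def vMeasure (k : ℝ) : Measure ℝ :=
  if k = 0 then Measure.dirac 1
  else (volume.restrict (Icc (-1) 1)).withDensity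
    (fun t => ENNReal.ofReal ((∫ s in Icc (-1 : ℝ) 1, vDensity k s)⁻¹ * vDensity k t))

/-- The intertwining operator `V_κ` of the group `ℤ₂ⁿ`:
`V_κ g(x) = c_κ ∫ g(x₁ t₁, …, xₙ tₙ) ∏ᵢ (1 + tᵢ) (1 - tᵢ²) ^ (κᵢ - 1) dt` over `[-1, 1]ⁿ`,
normalized by `V_κ 1 = 1`. -/
def V {n : ℕ} (κ : Fin n → ℝ) (g : EuclideanSpace ℝ (Fin n) → ℝ)
    (x : EuclideanSpace ℝ (Fin n)) : ℝ :=
  ∫ t, g (WithLp.toLp 2 (fun i => x i * t i)) ∂(Measure.pi (fun i => vMeasure (κ i)))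

/-- `(x, x_{d+1}) ↦ (x, -x_{d+1})`. -/
def flipLast {d : ℕ} (z : EuclideanSpace ℝ (Fin (d + 1))) : EuclideanSpace ℝ (Fin (d + 1)) :=
  WithLp.toLp 2 (fun i => if i = Fin.last d then -z i else z i)

/-- `V_κ^B g(x, x_{d+1}) = (V_κ g(x, x_{d+1}) + V_κ g(x, -x_{d+1})) / 2`. -/
def VB {d : ℕ} (κ : Fin (d + 1) → ℝ) (g : EuclideanSpace ℝ (Fin (d + 1)) → ℝ)
    (z : EuclideanSpace ℝ (Fin (d + 1))) : ℝ :=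
  (1 / 2) * (V κ g z + V κ g (flipLast z))

/-- The lift `x ↦ X = (x, √(1 - ‖x‖²))` of the ball to the upper half sphere. -/
def lift {d : ℕ} (x : EuclideanSpace ℝ (Fin d)) : EuclideanSpace ℝ (Fin (d + 1)) :=
  WithLp.toLp 2 (Fin.snoc (α := fun _ => ℝ) (fun i => x i) (√(1 - ‖x‖ ^ 2)))

/-- The closed unit ball `B^d`. -/
abbrev B (d : ℕ) : Set (EuclideanSpace ℝ (Fin d)) := Metric.closedBall 0 1

/-- The weight `W_κ^B(x) = ∏_{i ≤ d} |xᵢ| ^ (2 κᵢ) (1 - ‖x‖²) ^ (κ_{d+1} - 1/2)` on `B^d`. -/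
def W {d : ℕ} (κ : Fin (d + 1) → ℝ) (x : EuclideanSpace ℝ (Fin d)) : ℝ :=
  (∏ i : Fin d, |x i| ^ (2 * κ i.castSucc)) * (1 - ‖x‖ ^ 2) ^ (κ (Fin.last d) - 1 / 2)

/-- The measure `W_κ^B(x) dx` on the ball `B^d`. -/
def measB {d : ℕ} (κ : Fin (d + 1) → ℝ) : Measure (EuclideanSpace ℝ (Fin d)) :=
  (volume.restrict (B d)).withDensity (fun y => ENNReal.ofReal (W κ y))

/-- The distance `d_B` on `B^d`. -/
def distB {d : ℕ} (x y : EuclideanSpace ℝ (Fin d)) : ℝ :=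
  Real.arccos (inner ℝ x y + √(1 - ‖x‖ ^ 2) * √(1 - ‖y‖ ^ 2))

/-- The closed `d_B`-ball `{y ∈ B^d : d_B(x, y) ≤ θ}`. -/
def capB {d : ℕ} (x : EuclideanSpace ℝ (Fin d)) (θ : ℝ) : Set (EuclideanSpace ℝ (Fin d)) :=
  {y | y ∈ B d ∧ distB x y ≤ θ}

/-- The set `e(x, θ)` of all `(y, y_{d+1}) ∈ B^{d+1}` with
`⟨x, y⟩ + √(1 - ‖x‖²) y_{d+1} ≥ cos θ` and `y_{d+1} ≥ 0`. -/
def e {d : ℕ} (x : EuclideanSpace ℝ (Fin d)) (θ : ℝ) : Set (EuclideanSpace ℝ (Fin (d + 1))) :=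
  {z | z ∈ B (d + 1) ∧
    Real.cos θ ≤ (∑ i : Fin d, x i * z i.castSucc) + √(1 - ‖x‖ ^ 2) * z (Fin.last d) ∧
    0 ≤ z (Fin.last d)}

/-- The kernel `y ↦ V_κ^B[χ_{e(x, θ)}](Y)`, where `Y = (y, √(1 - ‖y‖²))`. -/
def kernelB {d : ℕ} (κ : Fin (d + 1) → ℝ) (x : EuclideanSpace ℝ (Fin d)) (θ : ℝ)
    (y : EuclideanSpace ℝ (Fin d)) : ℝ :=
  VB κ ((e x θ).indicator (fun _ => 1)) (lift y)

/-- The maximal function `𝓜_κ^B f`, with values in `[0, ∞]`. -/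
def calM {d : ℕ} (κ : Fin (d + 1) → ℝ) (f : EuclideanSpace ℝ (Fin d) → ℝ)
    (x : EuclideanSpace ℝ (Fin d)) : ℝ≥0∞ :=
  ⨆ θ ∈ Ioc (0 : ℝ) Real.pi,
    (∫⁻ y, ENNReal.ofReal |f y| * ENNReal.ofReal (kernelB κ x θ y) ∂(measB κ)) /
      (∫⁻ y, ENNReal.ofReal (kernelB κ x θ y) ∂(measB κ))

/-- The weighted Hardy–Littlewood maximal function `M_κ^B f` for the distance `d_B`, with values
in `[0, ∞]`. -/
def hlM {d : ℕ} (κ : Fin (d + 1) → ℝ) (f : EuclideanSpace ℝ (Fin d) → ℝ)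
    (x : EuclideanSpace ℝ (Fin d)) : ℝ≥0∞ :=
  ⨆ θ ∈ Ioc (0 : ℝ) Real.pi,
    (∫⁻ y in capB x θ, ENNReal.ofReal |f y| ∂(measB κ)) / measB κ (capB x θ)

/-- The action `x ε = (x₁ ε₁, …, x_d ε_d)` of `ε ∈ ℤ₂^d = {1, -1}^d`. -/
def signAct {d : ℕ} (x : EuclideanSpace ℝ (Fin d)) (ε : Fin d → ℤˣ) :
    EuclideanSpace ℝ (Fin d) :=
  WithLp.toLp 2 (fun i => x i * ((ε i : ℤ) : ℝ))

end

end BallMax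

/-!
The map `lift` carries `d_B` to the angular distance on the upper half sphere of `ℝ^{d+1}`, and the
factor `(1 - ‖x‖²) ^ (-1/2)` of the weight is the Jacobian of this chart. Integrating radially,
`θ * measB κ (capB x θ)` is therefore comparable to the measure of the Euclidean ball of radius `θ`
about `X = lift x` with respect to `∏ |zᵢ| ^ (2 κᵢ) dz`, which is comparable to
`θ ^ (d + 1) * ∏ (|Xᵢ| + θ) ^ (2 κᵢ)`. This quantity is doubling in `θ` and depends only on the
`|Xᵢ|`, so the caps of radius `θ` about all the points `x ε` have comparable measure.

The kernel at `y` averages, over the two signs of the last coordinate of `lift y`, the probability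
that a random coordinatewise dilation by `t` lands in `e x θ`. Landing there forces `y` into
one of the caps of radius `θ` about the points `x ε`, and forces
`1 - |tᵢ| ≲ (θ / (|Xᵢ| + θ))²` for every `i`, an event of probability at most a constant times
`∏ (θ / (|Xᵢ| + θ)) ^ (2 κᵢ)`. On the cap of radius `θ / 4` about `x` the probability is also
bounded below by a multiple of this product, which cancels in the quotient defining `calM`.
-/

namespace BallMax

/-! ### Polar coordinates in a half space -/

section Polar

theorem lintegral_Ioi_eq_lintegral_comp_sqrt {a : ℝ} (ha : 0 ≤ a) (g : ℝ → ℝ≥0∞) :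
    ∫⁻ z in Ioi (0 : ℝ), g z =
      ∫⁻ r in Ioi a, ENNReal.ofReal (r / √(r ^ 2 - a ^ 2)) * g (√(r ^ 2 - a ^ 2)) := by
  have hpos : ∀ r ∈ Ioi a, 0 < r ^ 2 - a ^ 2 := fun r (hr : a < r) => by nlinarith
  have himage : (fun r => √(r ^ 2 - a ^ 2)) '' Ioi a = Ioi 0 := by
    refine Subset.antisymm (image_subset_iff.2 fun r hr => Real.sqrt_pos.2 (hpos r hr)) ?_
    intro z (hz : 0 < z)
    refine ⟨√(z ^ 2 + a ^ 2), Real.lt_sqrt_of_sq_lt (by nlinarith), ?_⟩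
    simp only [Real.sq_sqrt (show 0 ≤ z ^ 2 + a ^ 2 by positivity), add_sub_cancel_right,
      Real.sqrt_sq hz.le]
  have hinj : InjOn (fun r => √(r ^ 2 - a ^ 2)) (Ioi a) := by
    intro r hr s hs h
    have hsq : r ^ 2 = s ^ 2 :=
      sub_left_injective ((Real.sqrt_inj (hpos r hr).le (hpos s hs).le).1 h)
    exact (sq_eq_sq₀ (ha.trans (le_of_lt hr)) (ha.trans (le_of_lt hs))).1 hsq
  have hderiv : ∀ r ∈ Ioi a, HasDerivWithinAt (fun r => √(r ^ 2 - a ^ 2))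
      (r / √(r ^ 2 - a ^ 2)) (Ioi a) r := fun r hr => by
    have h := ((hasDerivAt_pow 2 r).sub_const (a ^ 2)).sqrt (hpos r hr).ne'
    rw [Nat.add_one_sub_one, pow_one, Nat.cast_ofNat, mul_div_mul_left _ _ two_ne_zero] at h
    exact h.hasDerivWithinAt
  rw [← himage, lintegral_image_eq_lintegral_abs_deriv_mul measurableSet_Ioi hderiv hinj]
  refine setLIntegral_congr_fun measurableSet_Ioi fun r (hr : a < r) => ?_
  rw [abs_of_nonneg (div_nonneg (ha.trans hr.le) (Real.sqrt_nonneg _))]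

variable {E : Type*} [NormedAddCommGroup E] [MeasurableSpace E] [BorelSpace E]
  {μ : Measure E}

theorem lintegral_lintegral_Ioi_norm_eq [SecondCountableTopology E] [SFinite μ]
    {G : E → ℝ → ℝ≥0∞} (hG : Measurable (Function.uncurry G)) :
    ∫⁻ w, (∫⁻ r in Ioi ‖w‖, G w r) ∂μ = ∫⁻ r in Ioi 0, ∫⁻ w in Metric.ball 0 r, G w r ∂μ := by
  let S : Set (E × ℝ) := {p | ‖p.1‖ < p.2}
  have hS : MeasurableSet S := measurableSet_lt (by fun_prop) (by fun_prop)
  have hleft : ∀ w, ∫⁻ r in Ioi ‖w‖, G w r = ∫⁻ r, S.indicator (Function.uncurry G) (w, r) :=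
    fun w => (lintegral_indicator measurableSet_Ioi _).symm
  have hright : ∀ r, ∫⁻ w in Metric.ball 0 r, G w r ∂μ =
      ∫⁻ w, S.indicator (Function.uncurry G) (w, r) ∂μ := fun r => by
    have hball : Metric.ball (0 : E) r = {w | (w, r) ∈ S} := by
      ext w
      exact mem_ball_zero_iff
    rw [← lintegral_indicator measurableSet_ball, hball]
    rfl
  have hnonpos : ∀ r ∉ Ioi (0 : ℝ), ∫⁻ w in Metric.ball 0 r, G w r ∂μ = 0 := fun r hr => by
    rw [Metric.ball_eq_empty.2 (not_lt.1 hr), setLIntegral_empty]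
  rw [← lintegral_indicator measurableSet_Ioi, indicator_eq_self.2 (Function.support_subset_iff'.2
    hnonpos)]
  simp_rw [hleft, hright]
  exact lintegral_lintegral_swap (hG.indicator hS).aemeasurable

variable [NormedSpace ℝ E] [FiniteDimensional ℝ E] [μ.IsAddHaarMeasure]

theorem setLIntegral_ball_eq_smul (g : E → ℝ≥0∞) {r : ℝ} (hr : 0 < r) :
    ∫⁻ w in Metric.ball 0 r, g w ∂μ =
      ENNReal.ofReal (r ^ Module.finrank ℝ E) * ∫⁻ y in Metric.ball 0 1, g (r • y) ∂μ := by
  have hemb : MeasurableEmbedding (fun y : E => r • y) :=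
    (Homeomorph.smulOfNeZero r hr.ne').measurableEmbedding
  have hball : (fun y : E => r • y) ⁻¹' Metric.ball 0 r = Metric.ball 0 1 := by
    ext y
    rw [mem_preimage, mem_ball_zero_iff, mem_ball_zero_iff, norm_smul, Real.norm_of_nonneg hr.le,
      mul_lt_iff_lt_one_right hr]
  have hmap := hemb.lintegral_map (μ := μ.restrict (Metric.ball 0 1)) g
  rw [← hball, ← hemb.restrict_map, Measure.map_addHaar_smul μ hr.ne', Measure.restrict_smul,
    lintegral_smul_measure, hball, smul_eq_mul] at hmap
  rw [← hmap, ← mul_assoc, ← ENNReal.ofReal_mul (by positivity), abs_of_pos (by positivity),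
    mul_inv_cancel₀ (by positivity), ENNReal.ofReal_one, one_mul]

theorem lintegral_halfSpace_eq_polar {F : E → ℝ → ℝ≥0∞} (hF : Measurable (Function.uncurry F)) :
    ∫⁻ w, (∫⁻ z in Ioi (0 : ℝ), F w z) ∂μ =
      ∫⁻ r in Ioi (0 : ℝ), ENNReal.ofReal (r ^ Module.finrank ℝ E) *
        ∫⁻ y in Metric.ball 0 1, ENNReal.ofReal (1 / √(1 - ‖y‖ ^ 2)) *
          F (r • y) (r * √(1 - ‖y‖ ^ 2)) ∂μ := by
  have hmeas : Measurable (Function.uncurry fun (w : E) (r : ℝ) =>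
      ENNReal.ofReal (r / √(r ^ 2 - ‖w‖ ^ 2)) * F w (√(r ^ 2 - ‖w‖ ^ 2))) := by
    have hsqrt : Measurable fun p : E × ℝ => (p.1, √(p.2 ^ 2 - ‖p.1‖ ^ 2)) := by fun_prop
    exact Measurable.mul (by fun_prop) (hF.comp hsqrt)
  rw [lintegral_congr fun w => lintegral_Ioi_eq_lintegral_comp_sqrt (norm_nonneg w) (F w),
    lintegral_lintegral_Ioi_norm_eq hmeas]
  refine setLIntegral_congr_fun measurableSet_Ioi fun r (hr : 0 < r) => ?_
  have hsqrt : ∀ y : E, √(r ^ 2 - ‖r • y‖ ^ 2) = r * √(1 - ‖y‖ ^ 2) := fun y => by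
    rw [norm_smul, Real.norm_of_nonneg hr.le, mul_pow, ← mul_one_sub,
      Real.sqrt_mul (by positivity), Real.sqrt_sq hr.le]
  simp only [setLIntegral_ball_eq_smul _ hr, hsqrt, ← div_div, div_self hr.ne']

end Polar

/-! ### The conical extension of the weight -/

section Cone

variable {n d : ℕ}

/-- The product weight `∏ |zᵢ| ^ (2 κᵢ)` on `ℝⁿ`. -/
noncomputable def coneWeight (κ : Fin n → ℝ) (z : EuclideanSpace ℝ (Fin n)) : ℝ :=
  ∏ i, |z i| ^ (2 * κ i)

/-- The homogeneous dimension `n + 2 ∑ κᵢ`, the degree of scaling of the measure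
`coneWeight κ z dz` on `ℝⁿ`. -/
noncomputable def homDim (κ : Fin n → ℝ) : ℝ := n + 2 * ∑ i, κ i

/-- The measure `coneWeight κ z dz` on the open upper half space of `ℝ^{d+1}`. In polar coordinates
its spherical part is `measB κ`, transported to the upper half sphere by `lift`. -/
noncomputable def coneMeasure (κ : Fin (d + 1) → ℝ) : Measure (EuclideanSpace ℝ (Fin (d + 1))) :=
  (volume.restrict {z | 0 < z (Fin.last d)}).withDensity fun z => ENNReal.ofReal (coneWeight κ z)

@[fun_prop]
theorem measurable_coneWeight (κ : Fin n → ℝ) : Measurable (coneWeight κ) := by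
  unfold coneWeight
  fun_prop

theorem coneWeight_smul (κ : Fin n → ℝ) {r : ℝ} (hr : 0 < r) (z : EuclideanSpace ℝ (Fin n)) :
    coneWeight κ (r • z) = r ^ (2 * ∑ i, κ i) * coneWeight κ z := by
  simp only [coneWeight, PiLp.smul_apply, smul_eq_mul, abs_mul, abs_of_pos hr,
    Real.mul_rpow hr.le (abs_nonneg _), Finset.prod_mul_distrib, Finset.mul_sum,
    Real.rpow_sum_of_pos hr]

@[simp]
theorem lift_castSucc (x : EuclideanSpace ℝ (Fin d)) (i : Fin d) : lift x i.castSucc = x i := by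
  simp [lift]

@[simp]
theorem lift_last (x : EuclideanSpace ℝ (Fin d)) : lift x (Fin.last d) = √(1 - ‖x‖ ^ 2) := by
  simp [lift]

@[fun_prop]
theorem continuous_lift : Continuous (lift (d := d)) := by
  unfold lift
  fun_prop

theorem div_sqrt_mul_coneWeight_lift (κ : Fin (d + 1) → ℝ) {y : EuclideanSpace ℝ (Fin d)}
    (hy : ‖y‖ < 1) : 1 / √(1 - ‖y‖ ^ 2) * coneWeight κ (lift y) = W κ y := by
  have hpos : 0 < 1 - ‖y‖ ^ 2 := by nlinarith [norm_nonneg y]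
  have hlast : |√(1 - ‖y‖ ^ 2)| ^ (2 * κ (Fin.last d)) = (1 - ‖y‖ ^ 2) ^ κ (Fin.last d) := by
    rw [abs_of_nonneg (Real.sqrt_nonneg _), Real.rpow_mul (Real.sqrt_nonneg _), Real.rpow_two,
      Real.sq_sqrt hpos.le]
  rw [coneWeight, Fin.prod_univ_castSucc]
  simp only [lift_castSucc, lift_last]
  rw [hlast, W, Real.rpow_sub hpos, Real.sqrt_eq_rpow]
  ring

theorem measB_apply (κ : Fin (d + 1) → ℝ) {S : Set (EuclideanSpace ℝ (Fin d))}
    (hS : MeasurableSet S) :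
    measB κ S = ∫⁻ y in Metric.ball 0 1, S.indicator (fun y => ENNReal.ofReal (W κ y)) y := by
  have hball : (Metric.ball 0 1 : Set (EuclideanSpace ℝ (Fin d))) =ᵐ[volume] B d := by
    rw [B, ← Metric.ball_union_sphere]
    exact (union_ae_eq_left_of_ae_eq_empty
      (ae_eq_empty.2 (Measure.addHaar_sphere_of_ne_zero _ _ one_ne_zero))).symm
  rw [measB, withDensity_apply _ hS, ← Measure.restrict_congr_set hball, lintegral_indicator hS]

theorem lintegral_euclideanSpace_succ {g : EuclideanSpace ℝ (Fin (d + 1)) → ℝ≥0∞}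
    (hg : Measurable g) :
    ∫⁻ z, g z = ∫⁻ w : EuclideanSpace ℝ (Fin d), ∫⁻ s : ℝ,
      g (WithLp.toLp 2 (Fin.snoc (α := fun _ => ℝ) (fun i => w i) s)) := by
  let split := MeasurableEquiv.piFinSuccAbove (fun _ : Fin (d + 1) => ℝ) (Fin.last d)
  have hsplit : ∀ p, split.symm p = Fin.snoc (α := fun _ => ℝ) p.2 p.1 := fun p =>
    Fin.insertNth_last' _ _
  have hmeas : Measurable fun p : ℝ × (Fin d → ℝ) => g (WithLp.toLp 2 (split.symm p)) := by
    fun_prop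
  rw [← (PiLp.volume_preserving_toLp (Fin (d + 1))).lintegral_comp hg,
    ← (volume_preserving_piFinSuccAbove (fun _ => ℝ) (Fin.last d)).symm.lintegral_comp
      (f := fun v => g (WithLp.toLp 2 v)) (by fun_prop),
    Measure.volume_eq_prod, lintegral_prod_symm _ hmeas.aemeasurable,
    ← (PiLp.volume_preserving_ofLp (Fin d)).lintegral_comp hmeas.lintegral_prod_left']
  simp only [hsplit]

theorem coneMeasure_eq_lintegral_lintegral_Ioi (κ : Fin (d + 1) → ℝ)
    {A : Set (EuclideanSpace ℝ (Fin (d + 1)))} (hA : MeasurableSet A) :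
    coneMeasure κ A = ∫⁻ w : EuclideanSpace ℝ (Fin d), ∫⁻ s in Ioi (0 : ℝ),
      A.indicator (fun z => ENNReal.ofReal (coneWeight κ z))
        (WithLp.toLp 2 (Fin.snoc (α := fun _ => ℝ) (fun i => w i) s)) := by
  have hupper : MeasurableSet {z : EuclideanSpace ℝ (Fin (d + 1)) | 0 < z (Fin.last d)} :=
    measurableSet_lt (by fun_prop) (by fun_prop)
  have hmeas : Measurable fun z => ENNReal.ofReal (coneWeight κ z) := by fun_prop
  rw [coneMeasure, withDensity_apply _ hA, ← lintegral_indicator hA, ← lintegral_indicator hupper,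
    lintegral_euclideanSpace_succ ((hmeas.indicator hA).indicator hupper)]
  refine lintegral_congr fun w => ?_
  rw [← lintegral_indicator measurableSet_Ioi]
  refine lintegral_congr fun s => ?_
  simp only [indicator_apply, mem_ofPred_eq, Fin.snoc_last, mem_Ioi]

theorem setLIntegral_ball_coneWeight_smul_lift (κ : Fin (d + 1) → ℝ)
    {A : Set (EuclideanSpace ℝ (Fin (d + 1)))} (hA : MeasurableSet A) {r : ℝ} (hr : 0 < r) :
    ∫⁻ y : EuclideanSpace ℝ (Fin d) in Metric.ball 0 1, ENNReal.ofReal (1 / √(1 - ‖y‖ ^ 2)) *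
        A.indicator (fun z => ENNReal.ofReal (coneWeight κ z)) (r • lift y) =
      ENNReal.ofReal (r ^ (2 * ∑ i, κ i)) * measB κ {y | r • lift y ∈ A} := by
  have hS : MeasurableSet {y : EuclideanSpace ℝ (Fin d) | r • lift y ∈ A} :=
    hA.preimage (by fun_prop)
  rw [measB_apply κ hS, ← lintegral_const_mul' _ _ ENNReal.ofReal_ne_top]
  refine setLIntegral_congr_fun measurableSet_ball fun y hy => ?_
  by_cases hyA : r • lift y ∈ A
  · simp only [indicator_of_mem hyA]
    rw [indicator_of_mem (show y ∈ {y | r • lift y ∈ A} from hyA), coneWeight_smul κ hr,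
      ← div_sqrt_mul_coneWeight_lift κ (mem_ball_zero_iff.1 hy),
      ← ENNReal.ofReal_mul (by positivity), ← ENNReal.ofReal_mul (by positivity), mul_left_comm]
  · simp only [indicator_of_notMem hyA]
    rw [indicator_of_notMem (show y ∉ {y | r • lift y ∈ A} from hyA), mul_zero, mul_zero]

theorem coneMeasure_apply (κ : Fin (d + 1) → ℝ) {A : Set (EuclideanSpace ℝ (Fin (d + 1)))}
    (hA : MeasurableSet A) :
    coneMeasure κ A = ∫⁻ r in Ioi (0 : ℝ),
      ENNReal.ofReal (r ^ (homDim κ - 1)) * measB κ {y | r • lift y ∈ A} := by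
  let F : EuclideanSpace ℝ (Fin d) → ℝ → ℝ≥0∞ := fun w s =>
    A.indicator (fun z => ENNReal.ofReal (coneWeight κ z))
      (WithLp.toLp 2 (Fin.snoc (α := fun _ => ℝ) (fun i => w i) s))
  have hF : Measurable (Function.uncurry F) :=
    Measurable.comp (g := A.indicator _) (Measurable.indicator (by fun_prop) hA) (by fun_prop)
  have hlift : ∀ (r : ℝ) (y : EuclideanSpace ℝ (Fin d)), WithLp.toLp 2 (Fin.snoc
      (α := fun _ => ℝ) (fun i => (r • y) i) (r * √(1 - ‖y‖ ^ 2))) = r • lift y := fun r y => by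
    ext i
    induction i using Fin.lastCases <;> simp
  rw [coneMeasure_eq_lintegral_lintegral_Ioi κ hA, lintegral_halfSpace_eq_polar hF,
    finrank_euclideanSpace_fin]
  refine setLIntegral_congr_fun measurableSet_Ioi fun r (hr : 0 < r) => ?_
  have hpow : r ^ (homDim κ - 1) = r ^ d * r ^ (2 * ∑ i, κ i) := by
    rw [← Real.rpow_natCast, ← Real.rpow_add hr, homDim]
    push_cast
    ring_nf
  simp only [F, hlift]
  rw [setLIntegral_ball_coneWeight_smul_lift κ hA hr, hpow, ENNReal.ofReal_mul (by positivity),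
    mul_assoc]

end Cone

/-! ### Caps and the lift to the sphere -/

section Cap

variable {d : ℕ} {x y : EuclideanSpace ℝ (Fin d)} {θ : ℝ}

theorem inner_lift (x y : EuclideanSpace ℝ (Fin d)) :
    inner ℝ (lift x) (lift y) = inner ℝ x y + √(1 - ‖x‖ ^ 2) * √(1 - ‖y‖ ^ 2) := by
  simp only [PiLp.inner_apply, Fin.sum_univ_castSucc, lift_castSucc, lift_last,
    RCLike.inner_apply, conj_trivial, mul_comm √(1 - ‖x‖ ^ 2)]

theorem norm_lift (hx : x ∈ B d) : ‖lift x‖ = 1 := by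
  have hx' : ‖x‖ ≤ 1 := mem_closedBall_zero_iff.1 hx
  have hnonneg : 0 ≤ 1 - ‖x‖ ^ 2 := by nlinarith [norm_nonneg x]
  rw [← sq_eq_sq₀ (norm_nonneg _) zero_le_one, ← real_inner_self_eq_norm_sq, inner_lift,
    real_inner_self_eq_norm_sq, Real.mul_self_sqrt hnonneg, add_sub_cancel, one_pow]

theorem cos_distB (hx : x ∈ B d) (hy : y ∈ B d) :
    Real.cos (distB x y) = inner ℝ (lift x) (lift y) := by
  have h := abs_real_inner_le_norm (lift x) (lift y)
  rw [norm_lift hx, norm_lift hy, one_mul, abs_le] at h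
  rw [distB, ← inner_lift, Real.cos_arccos h.1 h.2]

theorem norm_lift_sub_lift_sq (hx : x ∈ B d) (hy : y ∈ B d) :
    ‖lift x - lift y‖ ^ 2 = 2 - 2 * inner ℝ (lift x) (lift y) := by
  rw [norm_sub_sq_real, norm_lift hx, norm_lift hy]
  ring

theorem norm_lift_sub_lift_le_distB (hx : x ∈ B d) (hy : y ∈ B d) :
    ‖lift x - lift y‖ ≤ distB x y := by
  refine (sq_le_sq₀ (norm_nonneg _) (show 0 ≤ distB x y from Real.arccos_nonneg _)).1 ?_
  rw [norm_lift_sub_lift_sq hx hy, ← cos_distB hx hy]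
  linarith [Real.one_sub_sq_div_two_le_cos (x := distB x y)]

theorem mem_capB_iff_cos_le_inner (hx : x ∈ B d) (hy : y ∈ B d) (hθ : θ ∈ Icc 0 Real.pi) :
    y ∈ capB x θ ↔ Real.cos θ ≤ inner ℝ (lift x) (lift y) := by
  have hdist : distB x y ∈ Icc 0 Real.pi := ⟨Real.arccos_nonneg _, Real.arccos_le_pi _⟩
  rw [← cos_distB hx hy, Real.strictAntiOn_cos.le_iff_ge hθ hdist]
  exact and_iff_right hy

theorem capB_min_pi (x : EuclideanSpace ℝ (Fin d)) (θ : ℝ) : capB x (min θ Real.pi) = capB x θ := by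
  ext y
  simp only [capB, mem_ofPred_eq, le_min_iff, show distB x y ≤ Real.pi from Real.arccos_le_pi _,
    and_true]

theorem cos_le_one_sub_sq_div_eight (hθ : |θ| ≤ Real.pi) : Real.cos θ ≤ 1 - θ ^ 2 / 8 := by
  have hpi : 1 / 8 ≤ 2 / Real.pi ^ 2 := by
    rw [div_le_div_iff₀ (by norm_num) (by positivity)]
    nlinarith [Real.pi_pos, Real.pi_lt_four]
  linarith [Real.cos_le_one_sub_mul_cos_sq hθ, mul_le_mul_of_nonneg_right hpi (sq_nonneg θ)]

theorem mem_capB_of_norm_lift_sub_lift_le (hx : x ∈ B d) (hy : y ∈ B d) (hθ : θ ∈ Icc 0 Real.pi)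
    (h : ‖lift x - lift y‖ ≤ θ / 2) : y ∈ capB x θ := by
  rw [mem_capB_iff_cos_le_inner hx hy hθ]
  have hsq : ‖lift x - lift y‖ ^ 2 ≤ (θ / 2) ^ 2 := by gcongr
  rw [norm_lift_sub_lift_sq hx hy] at hsq
  linarith [cos_le_one_sub_sq_div_eight ((abs_of_nonneg hθ.1).trans_le hθ.2)]

theorem measurableSet_capB (x : EuclideanSpace ℝ (Fin d)) (θ : ℝ) : MeasurableSet (capB x θ) := by
  have hcont : Continuous (distB x) := by
    unfold distB
    fun_prop
  exact (Metric.isClosed_closedBall.inter (isClosed_le hcont continuous_const)).measurableSet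

end Cap

/-! ### The size of balls and caps -/

section BoxSize

variable {n d : ℕ}

/-- The quantity `h ^ n ∏ (|Xᵢ| + h) ^ (2 κᵢ)`, comparable to the measure of the ball of radius `h`
about `X` with respect to `coneWeight κ z dz`. -/
noncomputable def boxSize (κ : Fin n → ℝ) (X : EuclideanSpace ℝ (Fin n)) (h : ℝ) : ℝ :=
  h ^ n * ∏ i, (|X i| + h) ^ (2 * κ i)

theorem boxSize_pos (κ : Fin n → ℝ) (X : EuclideanSpace ℝ (Fin n)) {h : ℝ} (hh : 0 < h) :
    0 < boxSize κ X h :=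
  mul_pos (pow_pos hh n) (Finset.prod_pos fun i _ => Real.rpow_pos_of_pos (by positivity) _)

theorem boxSize_mul_le {κ : Fin n → ℝ} (hκ : ∀ i, 0 ≤ κ i) (X : EuclideanSpace ℝ (Fin n))
    {L h : ℝ} (hL : 1 ≤ L) (hh : 0 ≤ h) :
    boxSize κ X (L * h) ≤ L ^ homDim κ * boxSize κ X h := by
  have hpos : 0 < L := zero_lt_one.trans_le hL
  have hfactor : ∀ i, (|X i| + L * h) ^ (2 * κ i) ≤ L ^ (2 * κ i) * (|X i| + h) ^ (2 * κ i) := by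
    intro i
    rw [← Real.mul_rpow hpos.le (by positivity), mul_add]
    gcongr
    · exact mul_nonneg zero_le_two (hκ i)
    · exact le_mul_of_one_le_left (abs_nonneg _) hL
  calc boxSize κ X (L * h)
      ≤ (L * h) ^ n * ∏ i, (L ^ (2 * κ i) * (|X i| + h) ^ (2 * κ i)) := by
        unfold boxSize
        gcongr with i
        exact hfactor i
    _ = L ^ homDim κ * boxSize κ X h := by
        rw [Finset.prod_mul_distrib, ← Real.rpow_sum_of_pos hpos, ← Finset.mul_sum, homDim,
          Real.rpow_add hpos, Real.rpow_natCast, boxSize]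
        ring

theorem volume_forall_mem_Icc (a b : Fin n → ℝ) :
    volume {z : EuclideanSpace ℝ (Fin n) | ∀ i, z i ∈ Icc (a i) (b i)} =
      ∏ i, ENNReal.ofReal (b i - a i) := by
  rw [← Real.volume_Icc_pi, ← (PiLp.volume_preserving_ofLp (Fin n)).measure_preimage
    measurableSet_Icc.nullMeasurableSet]
  congr 1
  ext z
  simp only [mem_ofPred_eq, mem_Icc, mem_preimage, Pi.le_def, forall_and]

theorem abs_sub_le_of_mem_closedBall {X z : EuclideanSpace ℝ (Fin n)} {h : ℝ}
    (hz : z ∈ Metric.closedBall X h) (i : Fin n) : |z i - X i| ≤ h :=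
  (PiLp.norm_apply_le (z - X) i).trans (mem_closedBall_iff_norm.1 hz)

theorem volume_closedBall_le (X : EuclideanSpace ℝ (Fin n)) {h : ℝ} (hh : 0 ≤ h) :
    volume (Metric.closedBall X h) ≤ ENNReal.ofReal ((2 * h) ^ n) := by
  calc volume (Metric.closedBall X h)
      ≤ volume {z : EuclideanSpace ℝ (Fin n) | ∀ i, z i ∈ Icc (X i - h) (X i + h)} := by
        refine measure_mono fun z hz i => ?_
        have hzi := abs_le.1 (abs_sub_le_of_mem_closedBall hz i)
        constructor <;> linarith
    _ = ENNReal.ofReal ((2 * h) ^ n) := by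
        rw [volume_forall_mem_Icc, ENNReal.ofReal_pow (by positivity)]
        simp only [add_sub_sub_cancel, ← two_mul, Finset.prod_const, Finset.card_univ,
          Fintype.card_fin]

theorem norm_le_mul_of_forall_abs_le {v : EuclideanSpace ℝ (Fin n)} {h : ℝ}
    (hv : ∀ i, |v i| ≤ h) : ‖v‖ ≤ n * h := by
  let b := EuclideanSpace.basisFun (Fin n) ℝ
  calc ‖v‖ = ‖∑ i, v i • b i‖ := congrArg norm (b.sum_repr v).symm
    _ ≤ ∑ i, ‖v i • b i‖ := norm_sum_le _ _
    _ ≤ ∑ _i : Fin n, h := Finset.sum_le_sum fun i _ => by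
        rw [norm_smul, b.norm_eq_one, mul_one]
        exact hv i
    _ = n * h := by rw [Finset.sum_const, Finset.card_univ, Fintype.card_fin, nsmul_eq_mul]

theorem coneMeasure_closedBall_le {κ : Fin (d + 1) → ℝ} (hκ : ∀ i, 0 ≤ κ i)
    (X : EuclideanSpace ℝ (Fin (d + 1))) {h : ℝ} (hh : 0 ≤ h) :
    coneMeasure κ (Metric.closedBall X h) ≤ ENNReal.ofReal (2 ^ (d + 1) * boxSize κ X h) := by
  have hweight : ∀ z ∈ Metric.closedBall X h,
      coneWeight κ z ≤ ∏ i, (|X i| + h) ^ (2 * κ i) := fun z hz => by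
    refine Finset.prod_le_prod (fun i _ => by positivity) fun i _ => ?_
    have habs : |z i| ≤ |X i| + h := by
      linarith [abs_sub_abs_le_abs_sub (z i) (X i), abs_sub_le_of_mem_closedBall hz i]
    exact Real.rpow_le_rpow (abs_nonneg _) habs (mul_nonneg zero_le_two (hκ i))
  calc coneMeasure κ (Metric.closedBall X h)
      = ∫⁻ z in Metric.closedBall X h ∩ {z | 0 < z (Fin.last d)},
          ENNReal.ofReal (coneWeight κ z) := by
        rw [coneMeasure, withDensity_apply _ measurableSet_closedBall,
          Measure.restrict_restrict measurableSet_closedBall]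
    _ ≤ ∫⁻ z in Metric.closedBall X h, ENNReal.ofReal (coneWeight κ z) :=
        lintegral_mono_set inter_subset_left
    _ ≤ ∫⁻ _ in Metric.closedBall X h, ENNReal.ofReal (∏ i, (|X i| + h) ^ (2 * κ i)) :=
        setLIntegral_mono' measurableSet_closedBall fun z hz =>
          ENNReal.ofReal_le_ofReal (hweight z hz)
    _ ≤ ENNReal.ofReal (∏ i, (|X i| + h) ^ (2 * κ i)) * ENNReal.ofReal ((2 * h) ^ (d + 1)) := by
        rw [setLIntegral_const]
        gcongr
        exact volume_closedBall_le X hh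
    _ = ENNReal.ofReal (2 ^ (d + 1) * boxSize κ X h) := by
        rw [← ENNReal.ofReal_mul (by positivity), boxSize, mul_pow, mul_comm, mul_assoc]

theorem le_coneMeasure_closedBall {κ : Fin (d + 1) → ℝ} (hκ : ∀ i, 0 ≤ κ i)
    {X : EuclideanSpace ℝ (Fin (d + 1))} (hX : 0 ≤ X (Fin.last d)) {h : ℝ} (hh : 0 < h) :
    ENNReal.ofReal (boxSize κ X h) ≤
      coneMeasure κ (Metric.closedBall X ((d + 1 : ℕ) * (2 * h))) := by
  let a : Fin (d + 1) → ℝ := fun i => if 0 ≤ X i then X i + h else X i - 2 * h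
  let Q : Set (EuclideanSpace ℝ (Fin (d + 1))) := {z | ∀ i, z i ∈ Icc (a i) (a i + h)}
  have hcoord : ∀ z ∈ Q, ∀ i, |X i| + h ≤ |z i| ∧ |z i - X i| ≤ 2 * h := fun z hz i => by
    have hzi := hz i
    rcases le_or_gt 0 (X i) with hi | hi
    · simp only [a, if_pos hi, mem_Icc] at hzi
      rw [abs_of_nonneg hi, abs_le]
      exact ⟨hzi.1.trans (le_abs_self _), by linarith, by linarith⟩
    · simp only [a, if_neg hi.not_ge, mem_Icc] at hzi
      rw [abs_of_neg hi, abs_le]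
      exact ⟨le_trans (by linarith) (neg_le_abs _), by linarith, by linarith⟩
  have hQ : Q ⊆ Metric.closedBall X ((d + 1 : ℕ) * (2 * h)) ∩ {z | 0 < z (Fin.last d)} := by
    refine fun z hz => ⟨mem_closedBall_iff_norm.2 ?_, ?_⟩
    · exact norm_le_mul_of_forall_abs_le fun i => (hcoord z hz i).2
    · have hlast := (hz (Fin.last d)).1
      simp only [a, if_pos hX] at hlast
      exact (add_pos_of_nonneg_of_pos hX hh).trans_le hlast
  calc ENNReal.ofReal (boxSize κ X h)
      = ∫⁻ _ in Q, ENNReal.ofReal (∏ i, (|X i| + h) ^ (2 * κ i)) := by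
        rw [setLIntegral_const, volume_forall_mem_Icc, boxSize, mul_comm,
          ENNReal.ofReal_mul (by positivity), ENNReal.ofReal_pow hh.le]
        simp only [add_sub_cancel_left, Finset.prod_const, Finset.card_univ, Fintype.card_fin]
    _ ≤ ∫⁻ z in Q, ENNReal.ofReal (coneWeight κ z) := by
        refine setLIntegral_mono (by fun_prop) fun z hz => ENNReal.ofReal_le_ofReal ?_
        refine Finset.prod_le_prod (fun i _ => by positivity) fun i _ => ?_
        exact Real.rpow_le_rpow (by positivity) (hcoord z hz i).1 (mul_nonneg zero_le_two (hκ i))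
    _ ≤ _ := by
        rw [coneMeasure, withDensity_apply _ measurableSet_closedBall,
          Measure.restrict_restrict measurableSet_closedBall]
        exact lintegral_mono_set hQ

end BoxSize

section CapSize

variable {d : ℕ} {κ : Fin (d + 1) → ℝ} {x y : EuclideanSpace ℝ (Fin d)} {θ : ℝ}

theorem one_le_homDim (hκ : ∀ i, 0 ≤ κ i) : 1 ≤ homDim κ := by
  have hsum : 0 ≤ ∑ i, κ i := Finset.sum_nonneg fun i _ => hκ i
  rw [homDim]
  push_cast
  linarith [Nat.cast_nonneg (α := ℝ) d]

theorem ae_mem_B (κ : Fin (d + 1) → ℝ) : ∀ᵐ y ∂measB κ, y ∈ B d :=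
  (withDensity_absolutelyContinuous _ _).ae_le (ae_restrict_mem measurableSet_closedBall)

theorem ofReal_mul_measB_capB_le_coneMeasure (hκ : ∀ i, 0 ≤ κ i) (hx : x ∈ B d) (θ : ℝ) :
    ENNReal.ofReal θ * measB κ (capB x θ) ≤
      coneMeasure κ (Metric.closedBall (lift x) (2 * θ)) := by
  have hmem : ∀ r ∈ Ioc 1 (1 + θ), ∀ y ∈ capB x θ,
      r • lift y ∈ Metric.closedBall (lift x) (2 * θ) := fun r hr y hy => by
    rw [mem_closedBall_iff_norm]
    calc ‖r • lift y - lift x‖ = ‖(r - 1) • lift y - (lift x - lift y)‖ := by congr 1; module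
      _ ≤ (r - 1) + distB x y := by
          refine (norm_sub_le _ _).trans (add_le_add ?_ (norm_lift_sub_lift_le_distB hx hy.1))
          rw [norm_smul, norm_lift hy.1, mul_one, Real.norm_of_nonneg (sub_nonneg.2 hr.1.le)]
      _ ≤ 2 * θ := by linarith [hr.2, hy.2]
  calc ENNReal.ofReal θ * measB κ (capB x θ)
      = ∫⁻ _ in Ioc 1 (1 + θ), measB κ (capB x θ) := by
        rw [setLIntegral_const, Real.volume_Ioc, add_sub_cancel_left, mul_comm]
    _ ≤ ∫⁻ r in Ioc 1 (1 + θ), ENNReal.ofReal (r ^ (homDim κ - 1)) *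
          measB κ {y | r • lift y ∈ Metric.closedBall (lift x) (2 * θ)} := by
        refine setLIntegral_mono' measurableSet_Ioc fun r hr => ?_
        have hpow : 1 ≤ r ^ (homDim κ - 1) :=
          Real.one_le_rpow hr.1.le (sub_nonneg.2 (one_le_homDim hκ))
        exact (measure_mono (hmem r hr)).trans
          (le_mul_of_one_le_left' (ENNReal.one_le_ofReal.2 hpow))
    _ ≤ coneMeasure κ (Metric.closedBall (lift x) (2 * θ)) := by
        rw [coneMeasure_apply κ measurableSet_closedBall]
        exact lintegral_mono_set fun r hr => zero_lt_one.trans hr.1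

theorem mem_Icc_and_mem_capB_of_smul_lift_mem_closedBall (hx : x ∈ B d) (hy : y ∈ B d)
    (hθ : θ ∈ Icc 0 Real.pi) {r : ℝ} (hr : 0 ≤ r)
    (h : r • lift y ∈ Metric.closedBall (lift x) (θ / 4)) :
    r ∈ Icc (1 - θ / 4) (1 + θ / 4) ∧ y ∈ capB x θ := by
  rw [mem_closedBall_iff_norm] at h
  have hr1 : |r - 1| ≤ θ / 4 := by
    have habs := (abs_norm_sub_norm_le (r • lift y) (lift x)).trans h
    rwa [norm_smul, norm_lift hx, norm_lift hy, mul_one, Real.norm_of_nonneg hr] at habs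
  refine ⟨?_, mem_capB_of_norm_lift_sub_lift_le hx hy hθ ?_⟩
  · constructor <;> linarith [abs_le.1 hr1]
  · calc ‖lift x - lift y‖ = ‖(r - 1) • lift y - (r • lift y - lift x)‖ := by congr 1; module
      _ ≤ |r - 1| + θ / 4 := by
          refine (norm_sub_le _ _).trans (add_le_add (le_of_eq ?_) h)
          rw [norm_smul, norm_lift hy, mul_one, Real.norm_eq_abs]
      _ ≤ θ / 2 := by linarith

theorem coneMeasure_closedBall_lift_le (hκ : ∀ i, 0 ≤ κ i) (hx : x ∈ B d)
    (hθ : θ ∈ Icc 0 Real.pi) :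
    coneMeasure κ (Metric.closedBall (lift x) (θ / 4)) ≤
      ENNReal.ofReal (2 ^ (homDim κ - 1)) * (ENNReal.ofReal θ * measB κ (capB x θ)) := by
  let I : Set ℝ := Icc (1 - θ / 4) (1 + θ / 4)
  have hmem : ∀ r > 0, ∀ᵐ y ∂measB κ, r • lift y ∈ Metric.closedBall (lift x) (θ / 4) →
      r ∈ I ∧ y ∈ capB x θ := fun r hr => (ae_mem_B κ).mono fun y hy =>
    mem_Icc_and_mem_capB_of_smul_lift_mem_closedBall hx hy hθ hr.le
  have hbound : ∀ r > 0, ENNReal.ofReal (r ^ (homDim κ - 1)) *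
      measB κ {y | r • lift y ∈ Metric.closedBall (lift x) (θ / 4)} ≤
        I.indicator (fun _ => ENNReal.ofReal (2 ^ (homDim κ - 1)) * measB κ (capB x θ)) r := by
    intro r hr
    by_cases hrI : r ∈ I
    · have hr2 : r ≤ 2 := by linarith [hrI.2, hθ.2, Real.pi_lt_four]
      rw [indicator_of_mem hrI]
      refine mul_le_mul' (ENNReal.ofReal_le_ofReal ?_)
        (measure_mono_ae ((hmem r hr).mono fun y hy h => (hy h).2))
      exact Real.rpow_le_rpow (le_of_lt hr) hr2 (sub_nonneg.2 (one_le_homDim hκ))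
    · have hnull : measB κ {y | r • lift y ∈ Metric.closedBall (lift x) (θ / 4)} = 0 :=
        measure_eq_zero_iff_ae_notMem.2 ((hmem r hr).mono fun y hy h => hrI (hy h).1)
      rw [hnull, mul_zero]
      exact zero_le
  calc coneMeasure κ (Metric.closedBall (lift x) (θ / 4))
      ≤ ∫⁻ r in Ioi 0,
          I.indicator (fun _ => ENNReal.ofReal (2 ^ (homDim κ - 1)) * measB κ (capB x θ)) r := by
        rw [coneMeasure_apply κ measurableSet_closedBall]
        exact setLIntegral_mono' measurableSet_Ioi hbound
    _ ≤ ENNReal.ofReal (2 ^ (homDim κ - 1)) * measB κ (capB x θ) * volume I :=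
        (setLIntegral_le_lintegral _ _).trans (lintegral_indicator_const measurableSet_Icc _).le
    _ ≤ ENNReal.ofReal (2 ^ (homDim κ - 1)) * (ENNReal.ofReal θ * measB κ (capB x θ)) := by
        rw [mul_assoc, mul_comm (measB κ _), Real.volume_Icc]
        gcongr
        linarith [hθ.1]

theorem ofReal_mul_measB_capB_le_boxSize (hκ : ∀ i, 0 ≤ κ i) :
    ∃ C : ℝ≥0, ∀ x ∈ B d, ∀ θ ≥ 0,
      ENNReal.ofReal θ * measB κ (capB x θ) ≤ C * ENNReal.ofReal (boxSize κ (lift x) θ) := by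
  refine ⟨Real.toNNReal (2 ^ (d + 1) * 2 ^ homDim κ), fun x hx θ hθ => ?_⟩
  calc ENNReal.ofReal θ * measB κ (capB x θ)
      ≤ ENNReal.ofReal (2 ^ (d + 1) * boxSize κ (lift x) (2 * θ)) :=
        (ofReal_mul_measB_capB_le_coneMeasure hκ hx θ).trans
          (coneMeasure_closedBall_le hκ _ (by positivity))
    _ ≤ ENNReal.ofReal (2 ^ (d + 1) * (2 ^ homDim κ * boxSize κ (lift x) θ)) := by
        gcongr
        exact boxSize_mul_le hκ _ one_le_two hθ
    _ = _ := by
        rw [← mul_assoc, ENNReal.ofReal_mul (by positivity)]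
        rfl

theorem boxSize_le_ofReal_mul_measB_capB (hκ : ∀ i, 0 ≤ κ i) :
    ∃ C : ℝ≥0, ∀ x ∈ B d, ∀ θ ∈ Ioc 0 Real.pi,
      ENNReal.ofReal (boxSize κ (lift x) θ) ≤ C * (ENNReal.ofReal θ * measB κ (capB x θ)) := by
  let L : ℝ := 8 * (d + 1 : ℕ)
  have hL : 1 ≤ L := by
    simp only [L]
    push_cast
    linarith [Nat.cast_nonneg (α := ℝ) d]
  have hpos : 0 < L := zero_lt_one.trans_le hL
  refine ⟨Real.toNNReal (L ^ homDim κ * 2 ^ (homDim κ - 1)), fun x hx θ hθ => ?_⟩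
  have hlast : 0 ≤ lift x (Fin.last d) := by simp only [lift_last, Real.sqrt_nonneg]
  have hradius : (d + 1 : ℕ) * (2 * (θ / L)) = θ / 4 := by
    simp only [L]
    field_simp
    ring
  calc ENNReal.ofReal (boxSize κ (lift x) θ)
      = ENNReal.ofReal (boxSize κ (lift x) (L * (θ / L))) := by rw [mul_div_cancel₀ θ hpos.ne']
    _ ≤ ENNReal.ofReal (L ^ homDim κ) * ENNReal.ofReal (boxSize κ (lift x) (θ / L)) := by
        rw [← ENNReal.ofReal_mul (by positivity)]
        exact ENNReal.ofReal_le_ofReal (boxSize_mul_le hκ _ hL (div_nonneg hθ.1.le hpos.le))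
    _ ≤ ENNReal.ofReal (L ^ homDim κ) * (ENNReal.ofReal (2 ^ (homDim κ - 1)) *
          (ENNReal.ofReal θ * measB κ (capB x θ))) := by
        gcongr
        refine (le_coneMeasure_closedBall hκ hlast (div_pos hθ.1 hpos)).trans ?_
        rw [hradius]
        exact coneMeasure_closedBall_lift_le hκ hx ⟨hθ.1.le, hθ.2⟩
    _ = _ := by
        rw [← mul_assoc, ← ENNReal.ofReal_mul (by positivity)]
        rfl

theorem measB_capB_lt_top (hκ : ∀ i, 0 ≤ κ i) (hx : x ∈ B d) (θ : ℝ) :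
    measB κ (capB x θ) < ∞ := by
  obtain ⟨C, hC⟩ := ofReal_mul_measB_capB_le_boxSize hκ
  have hprod : ENNReal.ofReal Real.pi * measB κ (capB x Real.pi) ≠ ∞ :=
    ((hC x hx _ Real.pi_pos.le).trans_lt (by finiteness)).ne
  have hpi : measB κ (capB x Real.pi) ≠ ∞ :=
    (ENNReal.lt_top_of_mul_ne_top_right hprod (ENNReal.ofReal_pos.2 Real.pi_pos).ne').ne
  have hsub : capB x θ ⊆ capB x Real.pi := fun y hy => ⟨hy.1, Real.arccos_le_pi _⟩
  exact (measure_mono hsub).trans_lt hpi.lt_top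

theorem measB_capB_pos (hκ : ∀ i, 0 ≤ κ i) (hx : x ∈ B d) (hθ : 0 < θ) :
    0 < measB κ (capB x θ) := by
  have hmin : 0 < min θ Real.pi := lt_min hθ Real.pi_pos
  obtain ⟨C, hC⟩ := boxSize_le_ofReal_mul_measB_capB hκ
  have h := hC x hx _ ⟨hmin, min_le_right _ _⟩
  rw [capB_min_pi] at h
  refine pos_of_ne_zero fun hzero => ?_
  rw [hzero, mul_zero, mul_zero, nonpos_iff_eq_zero, ENNReal.ofReal_eq_zero] at h
  exact (boxSize_pos κ _ hmin).not_ge h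

theorem exists_measB_capB_mul_le (hκ : ∀ i, 0 ≤ κ i) {L : ℝ} (hL : 1 ≤ L) :
    ∃ C : ℝ≥0, ∀ x ∈ B d, ∀ x' ∈ B d, (∀ i, |lift x' i| = |lift x i|) →
      ∀ θ ∈ Ioc 0 Real.pi, measB κ (capB x' (L * θ)) ≤ C * measB κ (capB x θ) := by
  obtain ⟨C₁, hC₁⟩ := ofReal_mul_measB_capB_le_boxSize hκ
  obtain ⟨C₂, hC₂⟩ := boxSize_le_ofReal_mul_measB_capB hκ
  refine ⟨C₁ * Real.toNNReal (L ^ homDim κ) * C₂, fun x hx x' hx' habs θ hθ => ?_⟩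
  have hL0 : 0 ≤ L := zero_le_one.trans hL
  have hsize : boxSize κ (lift x') (L * θ) ≤ L ^ homDim κ * boxSize κ (lift x) θ := by
    rw [show boxSize κ (lift x') (L * θ) = boxSize κ (lift x) (L * θ) by simp only [boxSize, habs]]
    exact boxSize_mul_le hκ _ hL hθ.1.le
  refine (ENNReal.mul_le_mul_iff_right (ENNReal.ofReal_pos.2 hθ.1).ne' ENNReal.ofReal_ne_top).1 ?_
  calc ENNReal.ofReal θ * measB κ (capB x' (L * θ))
      ≤ ENNReal.ofReal (L * θ) * measB κ (capB x' (L * θ)) := by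
        gcongr
        exact le_mul_of_one_le_left hθ.1.le hL
    _ ≤ C₁ * ENNReal.ofReal (boxSize κ (lift x') (L * θ)) :=
        hC₁ x' hx' _ (mul_nonneg hL0 hθ.1.le)
    _ ≤ C₁ * (ENNReal.ofReal (L ^ homDim κ) * ENNReal.ofReal (boxSize κ (lift x) θ)) := by
        rw [← ENNReal.ofReal_mul (by positivity)]
        gcongr
    _ ≤ C₁ * (ENNReal.ofReal (L ^ homDim κ) * (C₂ * (ENNReal.ofReal θ * measB κ (capB x θ)))) := by
        gcongr
        exact hC₂ x hx θ hθ
    _ = _ := by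
        rw [ENNReal.ofReal, ENNReal.coe_mul, ENNReal.coe_mul]
        ring

theorem exists_measB_capB_two_mul_le (hκ : ∀ i, 0 ≤ κ i) :
    ∃ C : ℝ≥0, ∀ x ∈ B d, ∀ θ > 0, measB κ (capB x (2 * θ)) ≤ C * measB κ (capB x θ) := by
  obtain ⟨C, hC⟩ := exists_measB_capB_mul_le hκ one_le_two
  refine ⟨C, fun x hx θ hθ => ?_⟩
  have hmin : min (2 * min θ Real.pi) Real.pi = min (2 * θ) Real.pi := by
    rw [mul_min_of_nonneg _ _ zero_le_two, min_assoc,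
      min_eq_right (le_mul_of_one_le_left Real.pi_pos.le one_le_two)]
  have h := hC x hx x hx (fun _ => rfl) (min θ Real.pi)
    ⟨lt_min hθ Real.pi_pos, min_le_right _ _⟩
  rwa [capB_min_pi, ← capB_min_pi x (2 * _), hmin, capB_min_pi] at h

end CapSize

/-! ### The one-dimensional intertwining measure -/

section VMeasure

variable {k δ : ℝ}

theorem vDensity_eq {t : ℝ} (hk : 0 < k) (ht : t ∈ Icc (-1 : ℝ) 1) :
    vDensity k t = (1 + t) ^ k * (1 - t) ^ (k - 1) := by
  have hadd : 0 ≤ 1 + t := by linarith [ht.1]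
  have hsub : 0 ≤ 1 - t := by linarith [ht.2]
  have hpow : (1 + t) * (1 + t) ^ (k - 1) = (1 + t) ^ k := by
    rcases hadd.eq_or_lt with hzero | hpos
    · rw [← hzero, zero_mul, Real.zero_rpow hk.ne']
    · rw [mul_comm, ← Real.rpow_add_one hpos.ne', sub_add_cancel]
  rw [vDensity, show 1 - t ^ 2 = (1 + t) * (1 - t) by ring, Real.mul_rpow hadd hsub, ← mul_assoc,
    hpow]

theorem vDensity_nonneg {t : ℝ} (ht : t ∈ Icc (-1 : ℝ) 1) : 0 ≤ vDensity k t := by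
  have hadd : 0 ≤ 1 + t := by linarith [ht.1]
  have hsub : 0 ≤ 1 - t ^ 2 := by nlinarith [ht.1, ht.2]
  unfold vDensity
  positivity

theorem vDensity_le {t : ℝ} (hk : 0 < k) (ht : t ∈ Icc (-1 : ℝ) 1) (hδ : 1 + t ≤ δ) :
    vDensity k t ≤ δ ^ k * (1 - t) ^ (k - 1) := by
  have hadd : 0 ≤ 1 + t := by linarith [ht.1]
  have hsub : 0 ≤ 1 - t := by linarith [ht.2]
  rw [vDensity_eq hk ht]
  gcongr

theorem le_vDensity {t : ℝ} (hk : 0 < k) (ht : t ∈ Icc (0 : ℝ) 1) :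
    (1 - t) ^ (k - 1) ≤ vDensity k t := by
  rw [vDensity_eq hk ⟨by linarith [ht.1], ht.2⟩]
  exact le_mul_of_one_le_left (Real.rpow_nonneg (sub_nonneg.2 ht.2) _)
    (Real.one_le_rpow (le_add_of_nonneg_right ht.1) hk.le)

@[fun_prop]
theorem measurable_vDensity (k : ℝ) : Measurable (vDensity k) := by
  unfold vDensity
  fun_prop

theorem integrableOn_one_sub_rpow (hk : 0 < k) (hδ : 0 ≤ δ) :
    IntegrableOn (fun t : ℝ => (1 - t) ^ (k - 1)) (Icc (1 - δ) 1) := by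
  have h : IntervalIntegrable (fun u : ℝ => u ^ (k - 1)) volume 0 δ :=
    intervalIntegral.intervalIntegrable_rpow' (by linarith)
  have hcomp := h.comp_sub_left 1
  rw [sub_zero] at hcomp
  exact (intervalIntegrable_iff_integrableOn_Icc_of_le (by linarith)).1 hcomp.symm

theorem lintegral_one_sub_rpow (hk : 0 < k) (hδ : 0 ≤ δ) {a : ℝ} (ha : 0 ≤ a) :
    ∫⁻ t in Icc (1 - δ) 1, ENNReal.ofReal (a * (1 - t) ^ (k - 1)) =
      ENNReal.ofReal (a * (δ ^ k / k)) := by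
  have hnonneg : ∀ t ∈ Icc (1 - δ) 1, 0 ≤ a * (1 - t) ^ (k - 1) := fun t ht =>
    mul_nonneg ha (Real.rpow_nonneg (sub_nonneg.2 ht.2) _)
  rw [← ofReal_integral_eq_lintegral_ofReal ((integrableOn_one_sub_rpow hk hδ).const_mul a)
    (ae_restrict_of_forall_mem measurableSet_Icc hnonneg), integral_const_mul,
    integral_Icc_eq_integral_Ioc, ← intervalIntegral.integral_of_le (by linarith),
    intervalIntegral.integral_comp_sub_left (fun u : ℝ => u ^ (k - 1)), sub_self, sub_sub_cancel,
    integral_rpow (Or.inl (by linarith)), sub_add_cancel, Real.zero_rpow hk.ne', sub_zero]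

theorem lintegral_vDensity_Icc_le (hk : 0 < k) (hδ : 0 ≤ δ) :
    ∫⁻ t in Icc (1 - δ) 1 ∩ Icc (-1) 1, ENNReal.ofReal (vDensity k t) ≤
      ENNReal.ofReal (2 ^ k * (δ ^ k / k)) := by
  rw [← lintegral_one_sub_rpow hk hδ (by positivity)]
  refine (setLIntegral_mono' (measurableSet_Icc.inter measurableSet_Icc) fun t ht => ?_).trans
    (lintegral_mono_set inter_subset_left)
  exact ENNReal.ofReal_le_ofReal (vDensity_le hk ht.2 (by linarith [ht.2.2]))

theorem lintegral_vDensity_Iic_le (hk : 0 < k) (hδ : 0 ≤ δ) :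
    ∫⁻ t in Iic (δ - 1) ∩ Icc (-1) 1, ENNReal.ofReal (vDensity k t) ≤
      ENNReal.ofReal (2 ^ k * (δ ^ k / k)) := by
  rw [← mul_div_assoc, mul_comm, mul_div_assoc,
    ← lintegral_one_sub_rpow hk zero_le_two (by positivity), show (1 : ℝ) - 2 = -1 by norm_num]
  refine (setLIntegral_mono' (measurableSet_Iic.inter measurableSet_Icc) fun t ht => ?_).trans
    (lintegral_mono_set inter_subset_right)
  exact ENNReal.ofReal_le_ofReal (vDensity_le hk ht.2 (by linarith [show t ≤ δ - 1 from ht.1]))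

theorem le_lintegral_vDensity_Icc (hk : 0 < k) (hδ : δ ∈ Icc (0 : ℝ) 1) :
    ENNReal.ofReal (δ ^ k / k) ≤ ∫⁻ t in Icc (1 - δ) 1, ENNReal.ofReal (vDensity k t) := by
  rw [← one_mul (δ ^ k / k), ← lintegral_one_sub_rpow hk hδ.1 zero_le_one]
  refine setLIntegral_mono' measurableSet_Icc fun t ht => ENNReal.ofReal_le_ofReal ?_
  rw [one_mul]
  exact le_vDensity hk ⟨(sub_nonneg.2 hδ.2).trans ht.1, ht.2⟩

theorem ofReal_integral_vDensity (hk : 0 < k) :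
    ENNReal.ofReal (∫ t in Icc (-1 : ℝ) 1, vDensity k t) =
      ∫⁻ t in Icc (-1) 1, ENNReal.ofReal (vDensity k t) := by
  have hnonneg : ∀ t ∈ Icc (-1 : ℝ) 1, 0 ≤ vDensity k t := fun t ht => vDensity_nonneg ht
  have hdom := (integrableOn_one_sub_rpow hk zero_le_two).const_mul (2 ^ k)
  rw [show (1 : ℝ) - 2 = -1 by norm_num] at hdom
  refine ofReal_integral_eq_lintegral_ofReal ?_
    (ae_restrict_of_forall_mem measurableSet_Icc hnonneg)
  refine hdom.mono' (measurable_vDensity k).aestronglyMeasurable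
    (ae_restrict_of_forall_mem measurableSet_Icc fun t ht => ?_)
  rw [Real.norm_of_nonneg (hnonneg t ht)]
  exact vDensity_le hk ht (by linarith [ht.2])

theorem integral_vDensity_pos (hk : 0 < k) : 0 < ∫ t in Icc (-1 : ℝ) 1, vDensity k t := by
  rw [← ENNReal.ofReal_pos, ofReal_integral_vDensity hk]
  calc 0 < ENNReal.ofReal (1 ^ k / k) := ENNReal.ofReal_pos.2 (by positivity)
    _ ≤ ∫⁻ t in Icc (1 - 1) 1, ENNReal.ofReal (vDensity k t) :=
        le_lintegral_vDensity_Icc hk ⟨zero_le_one, le_rfl⟩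
    _ ≤ ∫⁻ t in Icc (-1) 1, ENNReal.ofReal (vDensity k t) :=
        lintegral_mono_set (Icc_subset_Icc_left (by norm_num))

theorem vMeasure_apply (hk : 0 < k) {S : Set ℝ} (hS : MeasurableSet S) :
    vMeasure k S = ENNReal.ofReal (∫ s in Icc (-1 : ℝ) 1, vDensity k s)⁻¹ *
      ∫⁻ t in S ∩ Icc (-1) 1, ENNReal.ofReal (vDensity k t) := by
  rw [vMeasure, if_neg hk.ne', withDensity_apply _ hS, Measure.restrict_restrict hS,
    ← lintegral_const_mul _ (by fun_prop)]
  simp only [ENNReal.ofReal_mul (inv_pos.2 (integral_vDensity_pos hk)).le]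

theorem isProbabilityMeasure_vMeasure (hk : 0 ≤ k) : IsProbabilityMeasure (vMeasure k) := by
  rcases hk.eq_or_lt with rfl | hk
  · rw [vMeasure, if_pos rfl]
    infer_instance
  · refine ⟨?_⟩
    have hpos := integral_vDensity_pos hk
    rw [vMeasure_apply hk .univ, univ_inter, ← ofReal_integral_vDensity hk,
      ← ENNReal.ofReal_mul (inv_pos.2 hpos).le, inv_mul_cancel₀ hpos.ne', ENNReal.ofReal_one]

theorem ae_vMeasure_abs_le_one (k : ℝ) : ∀ᵐ t ∂vMeasure k, |t| ≤ 1 := by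
  rw [vMeasure]
  split_ifs
  · rw [ae_dirac_eq, Filter.eventually_pure, abs_one]
  · exact (withDensity_absolutelyContinuous _ _).ae_le
      (ae_restrict_of_forall_mem measurableSet_Icc fun t ht => abs_le.2 ht)

theorem exists_vMeasure_one_sub_abs_le (hk : 0 ≤ k) :
    ∃ C > 0, ∀ δ ≥ 0, vMeasure k {t | 1 - |t| ≤ δ} ≤ ENNReal.ofReal (C * δ ^ k) := by
  have := isProbabilityMeasure_vMeasure hk
  rcases hk.eq_or_lt with rfl | hk
  · refine ⟨1, zero_lt_one, fun δ _ => ?_⟩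
    rw [Real.rpow_zero, mul_one, ENNReal.ofReal_one]
    exact prob_le_one
  have hc : 0 < (∫ s in Icc (-1 : ℝ) 1, vDensity k s)⁻¹ := inv_pos.2 (integral_vDensity_pos hk)
  refine ⟨(∫ s in Icc (-1 : ℝ) 1, vDensity k s)⁻¹ * (2 * 2 ^ k / k), by positivity, fun δ hδ => ?_⟩
  have hsub : {t : ℝ | 1 - |t| ≤ δ} ∩ Icc (-1) 1 ⊆
      (Icc (1 - δ) 1 ∩ Icc (-1) 1) ∪ (Iic (δ - 1) ∩ Icc (-1) 1) := by
    rintro t ⟨ht, ht1⟩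
    have hle : 1 - δ ≤ |t| := sub_le_comm.1 ht
    rcases le_abs'.1 hle with hneg | hpos
    · exact .inr ⟨by rwa [neg_sub] at hneg, ht1⟩
    · exact .inl ⟨⟨hpos, ht1.2⟩, ht1⟩
  rw [vMeasure_apply hk (measurableSet_le (by fun_prop) measurable_const), mul_assoc,
    ENNReal.ofReal_mul hc.le]
  gcongr
  calc ∫⁻ t in {t : ℝ | 1 - |t| ≤ δ} ∩ Icc (-1) 1, ENNReal.ofReal (vDensity k t)
      ≤ ENNReal.ofReal (2 ^ k * (δ ^ k / k)) + ENNReal.ofReal (2 ^ k * (δ ^ k / k)) :=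
        (lintegral_mono_set hsub).trans ((lintegral_union_le _ _ _).trans
          (add_le_add (lintegral_vDensity_Icc_le hk hδ) (lintegral_vDensity_Iic_le hk hδ)))
    _ = ENNReal.ofReal (2 * 2 ^ k / k * δ ^ k) := by
        rw [← ENNReal.ofReal_add (by positivity) (by positivity)]
        congr 1
        ring

theorem exists_le_vMeasure_Icc (hk : 0 ≤ k) :
    ∃ c > 0, ∀ δ ∈ Icc (0 : ℝ) 1, ENNReal.ofReal (c * δ ^ k) ≤ vMeasure k (Icc (1 - δ) 1) := by
  rcases hk.eq_or_lt with rfl | hk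
  · refine ⟨1, zero_lt_one, fun δ hδ => ?_⟩
    have hmem : (1 : ℝ) ∈ Icc (1 - δ) 1 := ⟨sub_le_self _ hδ.1, le_rfl⟩
    rw [vMeasure, if_pos rfl, Real.rpow_zero, mul_one, ENNReal.ofReal_one,
      Measure.dirac_apply_of_mem hmem]
  have hc : 0 < (∫ s in Icc (-1 : ℝ) 1, vDensity k s)⁻¹ := inv_pos.2 (integral_vDensity_pos hk)
  refine ⟨(∫ s in Icc (-1 : ℝ) 1, vDensity k s)⁻¹ * (1 / k), by positivity, fun δ hδ => ?_⟩
  have hsub : Icc (1 - δ) 1 ⊆ Icc (-1) 1 := Icc_subset_Icc_left (by linarith [hδ.2])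
  rw [vMeasure_apply hk measurableSet_Icc, inter_eq_left.2 hsub, mul_assoc, one_div_mul_eq_div,
    ENNReal.ofReal_mul hc.le]
  gcongr
  exact le_lintegral_vDensity_Icc hk hδ

end VMeasure

/-! ### The intertwining operator as an average over dilations -/

section Intertwining

variable {n : ℕ} {κ : Fin n → ℝ}

/-- The coordinatewise dilation `(z₁ t₁, …, zₙ tₙ)`. -/
noncomputable def dilate (z : EuclideanSpace ℝ (Fin n)) (t : Fin n → ℝ) :
    EuclideanSpace ℝ (Fin n) :=
  WithLp.toLp 2 fun i => z i * t i

/-- The measure `μ_z` representing the intertwining operator: `V κ g z = ∫ g dμ_z`. It is the law of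
the dilation of `z` by independent factors `tᵢ` with laws `vMeasure (κ i)`. -/
noncomputable def intertwiningMeasure (κ : Fin n → ℝ) (z : EuclideanSpace ℝ (Fin n)) :
    Measure (EuclideanSpace ℝ (Fin n)) :=
  (Measure.pi fun i => vMeasure (κ i)).map (dilate z)

theorem measurable_dilate (z : EuclideanSpace ℝ (Fin n)) : Measurable (dilate z) := by
  unfold dilate
  fun_prop

theorem norm_dilate_le (z : EuclideanSpace ℝ (Fin n)) {t : Fin n → ℝ} (ht : ∀ i, |t i| ≤ 1) :
    ‖dilate z t‖ ≤ ‖z‖ := by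
  rw [EuclideanSpace.norm_eq, EuclideanSpace.norm_eq]
  gcongr with i
  exact (norm_mul_le _ _).trans (mul_le_of_le_one_right (norm_nonneg _) (ht i))

theorem inner_dilate (X Z : EuclideanSpace ℝ (Fin n)) (t : Fin n → ℝ) :
    inner ℝ X (dilate Z t) = ∑ i, X i * Z i * t i := by
  rw [PiLp.inner_apply]
  exact Finset.sum_congr rfl fun i _ => by
    rw [dilate, RCLike.inner_apply, conj_trivial, mul_comm, mul_assoc]

theorem inner_dilate_le_sum_abs (X Z : EuclideanSpace ℝ (Fin n)) (t : Fin n → ℝ) :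
    inner ℝ X (dilate Z t) ≤ ∑ i, |X i| * |Z i| * |t i| := by
  rw [inner_dilate]
  refine Finset.sum_le_sum fun i _ => ?_
  rw [← abs_mul, ← abs_mul]
  exact le_abs_self _

theorem V_indicator_one {S : Set (EuclideanSpace ℝ (Fin n))} (hS : MeasurableSet S)
    (z : EuclideanSpace ℝ (Fin n)) :
    V κ (S.indicator fun _ => 1) z = (intertwiningMeasure κ z).real S := by
  rw [intertwiningMeasure, map_measureReal_apply (measurable_dilate z) hS,
    ← integral_indicator_one (measurable_dilate z hS)]
  rfl

theorem ae_pi_vMeasure_abs_le_one (hκ : ∀ i, 0 ≤ κ i) :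
    ∀ᵐ t ∂(Measure.pi fun i => vMeasure (κ i)), ∀ i, |t i| ≤ 1 := by
  have := fun i => isProbabilityMeasure_vMeasure (hκ i)
  exact ae_all_iff.2 fun i => (Measure.tendsto_eval_ae_ae (μ := fun i => vMeasure (κ i))
    (i := i)).eventually (ae_vMeasure_abs_le_one (κ i))

theorem exists_pi_vMeasure_one_sub_abs_le (hκ : ∀ i, 0 ≤ κ i) :
    ∃ C : ℝ≥0, ∀ ρ : Fin n → ℝ, (∀ i, 0 ≤ ρ i) →
      (Measure.pi fun i => vMeasure (κ i)) {t | ∀ i, 1 - |t i| ≤ ρ i} ≤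
        C * ENNReal.ofReal (∏ i, ρ i ^ κ i) := by
  have := fun i => isProbabilityMeasure_vMeasure (hκ i)
  choose C hC0 hC using fun i => exists_vMeasure_one_sub_abs_le (hκ i)
  refine ⟨Real.toNNReal (∏ i, C i), fun ρ hρ => ?_⟩
  calc (Measure.pi fun i => vMeasure (κ i)) {t | ∀ i, 1 - |t i| ≤ ρ i}
      = ∏ i, vMeasure (κ i) {s | 1 - |s| ≤ ρ i} := by
        rw [← Measure.pi_pi]
        congr 1
        ext t
        simp only [mem_univ_pi, mem_ofPred_eq]
    _ ≤ ∏ i, ENNReal.ofReal (C i * ρ i ^ κ i) := Finset.prod_le_prod' fun i _ => hC i _ (hρ i)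
    _ = ENNReal.ofReal (∏ i, C i * ρ i ^ κ i) :=
        (ENNReal.ofReal_prod_of_nonneg fun i _ =>
          mul_nonneg (hC0 i).le (Real.rpow_nonneg (hρ i) _)).symm
    _ = _ := by
        rw [Finset.prod_mul_distrib, ENNReal.ofReal_mul (Finset.prod_nonneg fun i _ => (hC0 i).le)]
        rfl

theorem exists_le_pi_vMeasure_Icc (hκ : ∀ i, 0 ≤ κ i) :
    ∃ C : ℝ≥0, ∀ ρ : Fin n → ℝ, (∀ i, ρ i ∈ Icc (0 : ℝ) 1) →
      ENNReal.ofReal (∏ i, ρ i ^ κ i) ≤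
        C * (Measure.pi fun i => vMeasure (κ i)) {t | ∀ i, t i ∈ Icc (1 - ρ i) 1} := by
  have := fun i => isProbabilityMeasure_vMeasure (hκ i)
  choose c hc0 hc using fun i => exists_le_vMeasure_Icc (hκ i)
  have hprod : 0 < ∏ i, c i := Finset.prod_pos fun i _ => hc0 i
  refine ⟨Real.toNNReal (∏ i, c i)⁻¹, fun ρ hρ => ?_⟩
  have hle : ENNReal.ofReal ((∏ i, c i) * ∏ i, ρ i ^ κ i) ≤
      (Measure.pi fun i => vMeasure (κ i)) {t | ∀ i, t i ∈ Icc (1 - ρ i) 1} := by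
    calc _ = ∏ i, ENNReal.ofReal (c i * ρ i ^ κ i) := by
          rw [← Finset.prod_mul_distrib, ENNReal.ofReal_prod_of_nonneg fun i _ =>
            mul_nonneg (hc0 i).le (Real.rpow_nonneg (hρ i).1 _)]
      _ ≤ ∏ i, vMeasure (κ i) (Icc (1 - ρ i) 1) := Finset.prod_le_prod' fun i _ => hc i _ (hρ i)
      _ = _ := by
          rw [← Measure.pi_pi]
          congr 1
          ext t
          simp only [mem_univ_pi, mem_ofPred_eq]
  calc ENNReal.ofReal (∏ i, ρ i ^ κ i)
      = ENNReal.ofReal (∏ i, c i)⁻¹ * ENNReal.ofReal ((∏ i, c i) * ∏ i, ρ i ^ κ i) := by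
        rw [← ENNReal.ofReal_mul (inv_pos.2 hprod).le, inv_mul_cancel_left₀ hprod.ne']
    _ ≤ _ := mul_le_mul_right hle _

end Intertwining

section KernelSize

variable {n : ℕ} {κ : Fin n → ℝ} {X Z : EuclideanSpace ℝ (Fin n)} {t : Fin n → ℝ} {θ : ℝ}

/-- The ratio `(θ / (|a| + θ))²`: the scale of those `1 - |t|` for which the dilation of a unit
vector by `t` can come within the angle `θ` of a unit vector with the coordinate `a`. -/
noncomputable def capRatio (a θ : ℝ) : ℝ := (θ / (|a| + θ)) ^ 2

/-- The size `∏ (θ / (|Xᵢ| + θ)) ^ (2 κᵢ)` of the intertwining measure of the cap of radius `θ`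
about `X`. -/
noncomputable def kernelSize (κ : Fin n → ℝ) (X : EuclideanSpace ℝ (Fin n)) (θ : ℝ) : ℝ :=
  ∏ i, capRatio (X i) θ ^ κ i

theorem capRatio_mem_Icc (a : ℝ) (hθ : 0 ≤ θ) : capRatio a θ ∈ Icc (0 : ℝ) 1 :=
  ⟨sq_nonneg _, pow_le_one₀ (by positivity)
    (div_le_one_of_le₀ (le_add_of_nonneg_left (abs_nonneg a)) (by positivity))⟩

theorem prod_mul_capRatio_rpow (κ : Fin n → ℝ) (X : EuclideanSpace ℝ (Fin n)) (θ : ℝ) {L : ℝ}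
    (hL : 0 < L) : ∏ i, (L * capRatio (X i) θ) ^ κ i = L ^ (∑ i, κ i) * kernelSize κ X θ := by
  rw [kernelSize, Real.rpow_sum_of_pos hL, ← Finset.prod_mul_distrib]
  exact Finset.prod_congr rfl fun i _ => Real.mul_rpow hL.le (sq_nonneg _)

theorem le_mul_capRatio {a b s : ℝ} (ha : 0 ≤ a) (hb : 0 ≤ b) (hs : s ∈ Icc (0 : ℝ) 1) (hθ : 0 < θ)
    (h : (a - b) ^ 2 + 2 * (a * b * s) ≤ θ ^ 2) : s ≤ 9 * capRatio a θ := by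
  have hs0 := hs.1
  rw [capRatio, abs_of_nonneg ha, div_pow, ← mul_div_assoc, le_div_iff₀ (by positivity)]
  rcases le_total a (2 * θ) with hle | hge
  · calc s * (a + θ) ^ 2 ≤ 1 * (2 * θ + θ) ^ 2 := by gcongr; exact hs.2
      _ = 9 * θ ^ 2 := by ring
  · have hsub : (a - b) ^ 2 ≤ θ ^ 2 := by linarith [show 0 ≤ a * b * s by positivity]
    have hhalf : a / 2 ≤ b := by linarith [abs_le.1 (abs_le_of_sq_le_sq hsub hθ.le)]
    have hprod : a * (a / 2) * s ≤ θ ^ 2 / 2 :=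
      calc a * (a / 2) * s ≤ a * b * s := by gcongr
        _ ≤ θ ^ 2 / 2 := by linarith [sq_nonneg (a - b)]
    calc s * (a + θ) ^ 2 ≤ s * (3 / 2 * a) ^ 2 := by gcongr; linarith
      _ ≤ 9 * θ ^ 2 := by linarith [sq_nonneg θ]

theorem sum_sq_abs_sub_add (hX : ‖X‖ = 1) (hZ : ‖Z‖ = 1) (t : Fin n → ℝ) :
    ∑ i, ((|X i| - |Z i|) ^ 2 + 2 * (|X i| * |Z i| * (1 - |t i|))) =
      2 - 2 * ∑ i, |X i| * |Z i| * |t i| := by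
  have hnorm : ∀ v : EuclideanSpace ℝ (Fin n), ‖v‖ = 1 → ∑ i, |v i| ^ 2 = 1 := fun v hv => by
    rw [← one_pow 2, ← hv, EuclideanSpace.norm_sq_eq]
    rfl
  calc _ = ∑ i, (|X i| ^ 2 + |Z i| ^ 2 - 2 * (|X i| * |Z i| * |t i|)) :=
        Finset.sum_congr rfl fun i _ => by ring
    _ = 2 - 2 * ∑ i, |X i| * |Z i| * |t i| := by
        rw [Finset.sum_sub_distrib, Finset.sum_add_distrib, hnorm X hX, hnorm Z hZ,
          ← Finset.mul_sum, one_add_one_eq_two]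

theorem one_sub_abs_le_mul_capRatio (hX : ‖X‖ = 1) (hZ : ‖Z‖ = 1) (ht : ∀ i, |t i| ≤ 1)
    (hθ : 0 < θ) (h : Real.cos θ ≤ inner ℝ X (dilate Z t)) (i : Fin n) :
    1 - |t i| ≤ 9 * capRatio (X i) θ := by
  have hmem : ∀ j, 1 - |t j| ∈ Icc (0 : ℝ) 1 := fun j =>
    ⟨sub_nonneg.2 (ht j), sub_le_self _ (abs_nonneg _)⟩
  have hterm := Finset.single_le_sum
    (f := fun j => (|X j| - |Z j|) ^ 2 + 2 * (|X j| * |Z j| * (1 - |t j|)))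
    (fun j _ => by have := (hmem j).1; positivity) (Finset.mem_univ i)
  rw [sum_sq_abs_sub_add hX hZ] at hterm
  have hsum := h.trans (inner_dilate_le_sum_abs X Z t)
  have hle := le_mul_capRatio (abs_nonneg (X i)) (abs_nonneg (Z i)) (hmem i) hθ
    (hterm.trans (by linarith [Real.one_sub_sq_div_two_le_cos (x := θ)]))
  rwa [capRatio, abs_abs] at hle

theorem abs_mul_abs_mul_capRatio_le {a b : ℝ} (hθ : 0 < θ) (hb : |b| ≤ |a| + θ) :
    |a| * |b| * capRatio a θ ≤ θ ^ 2 := by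
  have hab : |a| * |b| ≤ (|a| + θ) ^ 2 := by
    rw [sq]
    gcongr
    linarith
  rw [capRatio, div_pow, ← mul_div_assoc, div_le_iff₀ (by positivity), mul_comm (θ ^ 2)]
  gcongr

theorem inner_sub_le_inner_dilate {c : ℝ} (hc : 0 ≤ c) (hθ : 0 < θ)
    (hZ : ∀ i, |Z i| ≤ |X i| + θ) (ht : ∀ i, t i ∈ Icc (1 - c * capRatio (X i) θ) 1) :
    inner ℝ X Z - n * (c * θ ^ 2) ≤ inner ℝ X (dilate Z t) := by
  have hterm : ∀ i, X i * Z i - X i * Z i * t i ≤ c * θ ^ 2 := fun i =>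
    calc X i * Z i - X i * Z i * t i = X i * Z i * (1 - t i) := by ring
      _ ≤ |X i| * |Z i| * (c * capRatio (X i) θ) := by
          rw [← abs_mul]
          exact mul_le_mul (le_abs_self _) (by linarith [(ht i).1]) (sub_nonneg.2 (ht i).2)
            (abs_nonneg _)
      _ = c * (|X i| * |Z i| * capRatio (X i) θ) := by ring
      _ ≤ c * θ ^ 2 := by
          gcongr
          exact abs_mul_abs_mul_capRatio_le hθ (hZ i)
  have hsum := Finset.sum_le_card_nsmul Finset.univ _ _ fun i _ => hterm i
  have hinner : inner ℝ X Z = ∑ i, X i * Z i := by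
    simp only [PiLp.inner_apply, RCLike.inner_apply, conj_trivial, mul_comm]
  rw [Finset.sum_sub_distrib, ← inner_dilate, ← hinner, Finset.card_univ, Fintype.card_fin,
    nsmul_eq_mul] at hsum
  linarith

end KernelSize

/-! ### The kernel -/

section Kernel

variable {d : ℕ} {κ : Fin (d + 1) → ℝ} {x y : EuclideanSpace ℝ (Fin d)} {θ : ℝ}
  {Z : EuclideanSpace ℝ (Fin (d + 1))} {t : Fin (d + 1) → ℝ}

theorem abs_signAct_apply (x : EuclideanSpace ℝ (Fin d)) (ε : Fin d → ℤˣ) (i : Fin d) :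
    |signAct x ε i| = |x i| := by
  rw [signAct, abs_mul]
  rcases Int.units_eq_one_or (ε i) with h | h <;> simp [h]

theorem norm_signAct (x : EuclideanSpace ℝ (Fin d)) (ε : Fin d → ℤˣ) : ‖signAct x ε‖ = ‖x‖ := by
  simp only [EuclideanSpace.norm_eq, Real.norm_eq_abs, abs_signAct_apply]

theorem signAct_mem_B (hx : x ∈ B d) (ε : Fin d → ℤˣ) : signAct x ε ∈ B d := by
  rwa [mem_closedBall_zero_iff, norm_signAct, ← mem_closedBall_zero_iff]

theorem abs_lift_signAct (x : EuclideanSpace ℝ (Fin d)) (ε : Fin d → ℤˣ) (i : Fin (d + 1)) :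
    |lift (signAct x ε) i| = |lift x i| := by
  cases i using Fin.lastCases with
  | last => rw [lift_last, lift_last, norm_signAct]
  | cast i => rw [lift_castSucc, lift_castSucc, abs_signAct_apply]

theorem exists_inner_lift_signAct (x y : EuclideanSpace ℝ (Fin d)) :
    ∃ ε : Fin d → ℤˣ,
      inner ℝ (lift (signAct x ε)) (lift y) = ∑ i, |lift x i| * |lift y i| := by
  refine ⟨fun i => if 0 ≤ x i * y i then 1 else -1, ?_⟩
  rw [inner_lift, norm_signAct, Fin.sum_univ_castSucc, lift_last, lift_last,
    abs_of_nonneg (Real.sqrt_nonneg _), abs_of_nonneg (Real.sqrt_nonneg _), PiLp.inner_apply]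
  congr 1
  refine Finset.sum_congr rfl fun i _ => ?_
  rw [lift_castSucc, lift_castSucc, ← abs_mul, signAct, RCLike.inner_apply, conj_trivial]
  dsimp only
  split_ifs with h
  · rw [abs_of_nonneg h, Units.val_one, Int.cast_one, mul_one, mul_comm]
  · rw [abs_of_neg (not_le.1 h), Units.val_neg, Units.val_one, Int.cast_neg, Int.cast_one,
      mul_neg_one, mul_neg, mul_comm]

theorem mem_e_iff : Z ∈ e x θ ↔
    Z ∈ B (d + 1) ∧ Real.cos θ ≤ inner ℝ (lift x) Z ∧ 0 ≤ Z (Fin.last d) := by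
  simp only [PiLp.inner_apply, RCLike.inner_apply, conj_trivial, mul_comm (Z _),
    Fin.sum_univ_castSucc, lift_castSucc, lift_last]
  rfl

theorem measurableSet_e (x : EuclideanSpace ℝ (Fin d)) (θ : ℝ) : MeasurableSet (e x θ) := by
  have hcap : IsClosed {Z : EuclideanSpace ℝ (Fin (d + 1)) | Real.cos θ ≤ inner ℝ (lift x) Z} :=
    isClosed_le continuous_const (by fun_prop)
  have hhalf : IsClosed {Z : EuclideanSpace ℝ (Fin (d + 1)) | 0 ≤ Z (Fin.last d)} :=
    isClosed_le continuous_const (by fun_prop)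
  have heq : e x θ = B (d + 1) ∩ ({Z | Real.cos θ ≤ inner ℝ (lift x) Z} ∩
      {Z | 0 ≤ Z (Fin.last d)}) := ext fun Z => mem_e_iff
  rw [heq]
  exact (Metric.isClosed_closedBall.inter (hcap.inter hhalf)).measurableSet

theorem intertwiningMeasure_e (κ : Fin (d + 1) → ℝ) (x : EuclideanSpace ℝ (Fin d)) (θ : ℝ)
    (Z : EuclideanSpace ℝ (Fin (d + 1))) :
    intertwiningMeasure κ Z (e x θ) =
      (Measure.pi fun i => vMeasure (κ i)) {t | dilate Z t ∈ e x θ} :=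
  Measure.map_apply (measurable_dilate Z) (measurableSet_e x θ)

theorem exists_mem_capB_signAct_of_dilate_mem_e (hx : x ∈ B d) (hy : y ∈ B d)
    (hθ : θ ∈ Icc 0 Real.pi) (hZ : ∀ i, |Z i| = |lift y i|) (ht : ∀ i, |t i| ≤ 1)
    (h : dilate Z t ∈ e x θ) : ∃ ε, y ∈ capB (signAct x ε) θ := by
  obtain ⟨ε, hε⟩ := exists_inner_lift_signAct x y
  refine ⟨ε, (mem_capB_iff_cos_le_inner (signAct_mem_B hx ε) hy hθ).2 ?_⟩
  calc Real.cos θ ≤ ∑ i, |lift x i| * |Z i| * |t i| :=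
        (mem_e_iff.1 h).2.1.trans (inner_dilate_le_sum_abs _ _ _)
    _ ≤ ∑ i, |lift x i| * |lift y i| := by
        refine Finset.sum_le_sum fun i _ => ?_
        rw [hZ i]
        exact mul_le_of_le_one_right (by positivity) (ht i)
    _ = inner ℝ (lift (signAct x ε)) (lift y) := hε.symm

theorem intertwiningMeasure_e_eq_zero (hκ : ∀ i, 0 ≤ κ i) (hx : x ∈ B d) (hy : y ∈ B d)
    (hθ : θ ∈ Icc 0 Real.pi) (hZ : ∀ i, |Z i| = |lift y i|)
    (h : y ∉ ⋃ ε, capB (signAct x ε) θ) : intertwiningMeasure κ Z (e x θ) = 0 := by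
  rw [intertwiningMeasure_e, measure_eq_zero_iff_ae_notMem]
  filter_upwards [ae_pi_vMeasure_abs_le_one hκ] with t ht hmem
  exact h (mem_iUnion.2 (exists_mem_capB_signAct_of_dilate_mem_e hx hy hθ hZ ht hmem))

theorem exists_intertwiningMeasure_e_le (hκ : ∀ i, 0 ≤ κ i) :
    ∃ C : ℝ≥0, ∀ x ∈ B d, ∀ θ > 0, ∀ Z : EuclideanSpace ℝ (Fin (d + 1)), ‖Z‖ = 1 →
      intertwiningMeasure κ Z (e x θ) ≤ C * ENNReal.ofReal (kernelSize κ (lift x) θ) := by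
  obtain ⟨C, hC⟩ := exists_pi_vMeasure_one_sub_abs_le hκ
  refine ⟨C * Real.toNNReal (9 ^ ∑ i, κ i), fun x hx θ hθ Z hZ => ?_⟩
  calc intertwiningMeasure κ Z (e x θ)
      ≤ (Measure.pi fun i => vMeasure (κ i)) {t | ∀ i, 1 - |t i| ≤ 9 * capRatio (lift x i) θ} := by
        rw [intertwiningMeasure_e]
        refine measure_mono_ae ?_
        filter_upwards [ae_pi_vMeasure_abs_le_one hκ] with t ht hmem
        exact one_sub_abs_le_mul_capRatio (norm_lift hx) hZ ht hθ (mem_e_iff.1 hmem).2.1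
    _ ≤ C * ENNReal.ofReal (∏ i, (9 * capRatio (lift x i) θ) ^ κ i) :=
        hC _ fun i => mul_nonneg (by norm_num) (capRatio_mem_Icc _ hθ.le).1
    _ = _ := by
        rw [prod_mul_capRatio_rpow _ _ _ (by norm_num), ENNReal.ofReal_mul (by positivity),
          ENNReal.coe_mul, mul_assoc]
        rfl

theorem cos_add_sq_div_sixteen_le_cos_div_four (hθ : |θ| ≤ Real.pi) :
    Real.cos θ + θ ^ 2 / 16 ≤ Real.cos (θ / 4) := by
  linarith [cos_le_one_sub_sq_div_eight hθ, Real.one_sub_sq_div_two_le_cos (x := θ / 4),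
    sq_nonneg θ]

theorem dilate_lift_mem_e (hx : x ∈ B d) (hθ : θ ∈ Ioc 0 Real.pi) (hy : y ∈ capB x (θ / 4))
    (ht : ∀ i, t i ∈ Icc (1 - (16 * (d + 1 : ℕ) : ℝ)⁻¹ * capRatio (lift x i) θ) 1) :
    dilate (lift y) t ∈ e x θ := by
  have hyB : y ∈ B d := hy.1
  have hc1 : (16 * (d + 1 : ℕ) : ℝ)⁻¹ ≤ 1 := by
    refine inv_le_one_of_one_le₀ ?_
    push_cast
    linarith [Nat.cast_nonneg (α := ℝ) d]
  have ht0 : ∀ i, 0 ≤ t i := fun i => by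
    have hρ := capRatio_mem_Icc (lift x i) hθ.1.le
    linarith [(ht i).1, mul_le_one₀ hc1 hρ.1 hρ.2]
  have hcoord : ∀ i, |lift y i| ≤ |lift x i| + θ := fun i => by
    have hdist := (PiLp.norm_apply_le (lift y - lift x) i).trans
      ((norm_sub_rev _ _).trans_le (norm_lift_sub_lift_le_distB hx hyB))
    rw [Real.norm_eq_abs, PiLp.sub_apply] at hdist
    linarith [abs_sub_abs_le_abs_sub (lift y i) (lift x i), hy.2, hθ.1]
  refine mem_e_iff.2 ⟨mem_closedBall_zero_iff.2 ?_, ?_, ?_⟩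
  · rw [← norm_lift hyB]
    exact norm_dilate_le _ fun i => abs_le.2 ⟨by linarith [ht0 i], (ht i).2⟩
  · have hcap : Real.cos (θ / 4) ≤ inner ℝ (lift x) (lift y) :=
      (mem_capB_iff_cos_le_inner hx hyB ⟨by linarith [hθ.1], by linarith [hθ.1, hθ.2]⟩).1 hy
    have hloss : ((d + 1 : ℕ) : ℝ) * ((16 * (d + 1 : ℕ) : ℝ)⁻¹ * θ ^ 2) = θ ^ 2 / 16 := by
      field_simp
    have hinner := inner_sub_le_inner_dilate (by positivity) hθ.1 hcoord ht
    have hcos := cos_add_sq_div_sixteen_le_cos_div_four ((abs_of_pos hθ.1).trans_le hθ.2)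
    linarith
  · exact mul_nonneg (by simp only [lift_last, Real.sqrt_nonneg]) (ht0 _)

theorem exists_le_intertwiningMeasure_e (hκ : ∀ i, 0 ≤ κ i) :
    ∃ C : ℝ≥0, ∀ x ∈ B d, ∀ θ ∈ Ioc 0 Real.pi, ∀ y ∈ capB x (θ / 4),
      ENNReal.ofReal (kernelSize κ (lift x) θ) ≤
        C * intertwiningMeasure κ (lift y) (e x θ) := by
  obtain ⟨C, hC⟩ := exists_le_pi_vMeasure_Icc hκ
  let c : ℝ := (16 * (d + 1 : ℕ) : ℝ)⁻¹
  have hc0 : 0 < c := by positivity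
  have hc1 : c ≤ 1 := by
    refine inv_le_one_of_one_le₀ ?_
    push_cast
    linarith [Nat.cast_nonneg (α := ℝ) d]
  have hpow : 0 < c ^ ∑ i, κ i := Real.rpow_pos_of_pos hc0 _
  refine ⟨Real.toNNReal (c ^ ∑ i, κ i)⁻¹ * C, fun x hx θ hθ y hy => ?_⟩
  have hρ : ∀ i, c * capRatio (lift x i) θ ∈ Icc (0 : ℝ) 1 := fun i =>
    have h := capRatio_mem_Icc (lift x i) hθ.1.le
    ⟨mul_nonneg hc0.le h.1, mul_le_one₀ hc1 h.1 h.2⟩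
  calc ENNReal.ofReal (kernelSize κ (lift x) θ)
      = ENNReal.ofReal (c ^ ∑ i, κ i)⁻¹ *
          ENNReal.ofReal (∏ i, (c * capRatio (lift x i) θ) ^ κ i) := by
        rw [← ENNReal.ofReal_mul (inv_pos.2 hpow).le, prod_mul_capRatio_rpow _ _ _ hc0,
          inv_mul_cancel_left₀ hpow.ne']
    _ ≤ ENNReal.ofReal (c ^ ∑ i, κ i)⁻¹ * (C * intertwiningMeasure κ (lift y) (e x θ)) := by
        gcongr
        rw [intertwiningMeasure_e]
        refine (hC _ hρ).trans ?_
        gcongr with t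
        exact dilate_lift_mem_e hx hθ hy
    _ = _ := by
        rw [ENNReal.coe_mul, mul_assoc]
        rfl

theorem ofReal_kernelB (hκ : ∀ i, 0 ≤ κ i) (x : EuclideanSpace ℝ (Fin d)) (θ : ℝ)
    (y : EuclideanSpace ℝ (Fin d)) :
    ENNReal.ofReal (kernelB κ x θ y) = 2⁻¹ * (intertwiningMeasure κ (lift y) (e x θ) +
      intertwiningMeasure κ (flipLast (lift y)) (e x θ)) := by
  have := fun i => isProbabilityMeasure_vMeasure (hκ i)
  have : ∀ z, IsFiniteMeasure (intertwiningMeasure κ z) := fun z => by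
    unfold intertwiningMeasure
    infer_instance
  rw [kernelB, VB, V_indicator_one (measurableSet_e x θ), V_indicator_one (measurableSet_e x θ),
    one_div, ENNReal.ofReal_mul (by norm_num), ENNReal.ofReal_inv_of_pos two_pos,
    ENNReal.ofReal_ofNat, ENNReal.ofReal_add measureReal_nonneg measureReal_nonneg,
    ofReal_measureReal, ofReal_measureReal]

theorem abs_flipLast_apply (z : EuclideanSpace ℝ (Fin (d + 1))) (i : Fin (d + 1)) :
    |flipLast z i| = |z i| := by
  rw [flipLast]
  dsimp only
  split_ifs
  · exact abs_neg _
  · rfl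

theorem norm_flipLast (z : EuclideanSpace ℝ (Fin (d + 1))) : ‖flipLast z‖ = ‖z‖ := by
  simp only [EuclideanSpace.norm_eq, Real.norm_eq_abs, abs_flipLast_apply]

theorem exists_ofReal_kernelB_le (hκ : ∀ i, 0 ≤ κ i) :
    ∃ C : ℝ≥0, ∀ x ∈ B d, ∀ y ∈ B d, ∀ θ ∈ Ioc 0 Real.pi,
      ENNReal.ofReal (kernelB κ x θ y) ≤
        (⋃ ε, capB (signAct x ε) θ).indicator
          (fun _ => C * ENNReal.ofReal (kernelSize κ (lift x) θ)) y := by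
  obtain ⟨C, hC⟩ := exists_intertwiningMeasure_e_le hκ
  refine ⟨C, fun x hx y hy θ hθ => ?_⟩
  rw [ofReal_kernelB hκ]
  by_cases h : y ∈ ⋃ ε, capB (signAct x ε) θ
  · have hflip : ‖flipLast (lift y)‖ = 1 := (norm_flipLast _).trans (norm_lift hy)
    rw [indicator_of_mem h]
    refine (mul_le_mul_right
      (add_le_add (hC x hx θ hθ.1 _ (norm_lift hy)) (hC x hx θ hθ.1 _ hflip)) _).trans_eq ?_
    rw [← two_mul, ENNReal.inv_mul_cancel_left two_ne_zero ENNReal.ofNat_ne_top]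
  · have hθ' : θ ∈ Icc 0 Real.pi := Ioc_subset_Icc_self hθ
    rw [indicator_of_notMem h, intertwiningMeasure_e_eq_zero hκ hx hy hθ' (fun _ => rfl) h,
      intertwiningMeasure_e_eq_zero hκ hx hy hθ' (abs_flipLast_apply _) h, add_zero, mul_zero]

theorem exists_le_ofReal_kernelB (hκ : ∀ i, 0 ≤ κ i) :
    ∃ C : ℝ≥0, ∀ x ∈ B d, ∀ θ ∈ Ioc 0 Real.pi, ∀ y ∈ capB x (θ / 4),
      ENNReal.ofReal (kernelSize κ (lift x) θ) ≤ C * ENNReal.ofReal (kernelB κ x θ y) := by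
  obtain ⟨C, hC⟩ := exists_le_intertwiningMeasure_e hκ
  refine ⟨C * 2, fun x hx θ hθ y hy => (hC x hx θ hθ y hy).trans ?_⟩
  rw [ofReal_kernelB hκ, ENNReal.coe_mul, ENNReal.coe_ofNat, mul_assoc,
    ENNReal.mul_inv_cancel_left two_ne_zero ENNReal.ofNat_ne_top]
  gcongr
  exact le_self_add

end Kernel

/-! ### The maximal functions -/

section Maximal

variable {d : ℕ} {κ : Fin (d + 1) → ℝ} {x : EuclideanSpace ℝ (Fin d)} {θ : ℝ}

theorem lintegral_capB_le_hlM_mul (hκ : ∀ i, 0 ≤ κ i) (f : EuclideanSpace ℝ (Fin d) → ℝ)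
    (hx : x ∈ B d) (hθ : θ ∈ Ioc 0 Real.pi) :
    ∫⁻ y in capB x θ, ENNReal.ofReal |f y| ∂measB κ ≤ hlM κ f x * measB κ (capB x θ) := by
  rw [← ENNReal.div_le_iff (measB_capB_pos hκ hx hθ.1).ne' (measB_capB_lt_top hκ hx θ).ne]
  exact le_iSup₂ (f := fun θ (_ : θ ∈ Ioc 0 Real.pi) =>
    (∫⁻ y in capB x θ, ENNReal.ofReal |f y| ∂measB κ) / measB κ (capB x θ)) θ hθ

theorem exists_lintegral_mul_kernelB_le (hκ : ∀ i, 0 ≤ κ i) :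
    ∃ C : ℝ≥0, ∀ f : EuclideanSpace ℝ (Fin d) → ℝ, ∀ x ∈ B d, ∀ θ ∈ Ioc 0 Real.pi,
      ∫⁻ y, ENNReal.ofReal |f y| * ENNReal.ofReal (kernelB κ x θ y) ∂measB κ ≤
        C * ENNReal.ofReal (kernelSize κ (lift x) θ) *
          ∑ ε, ∫⁻ y in capB (signAct x ε) θ, ENNReal.ofReal |f y| ∂measB κ := by
  obtain ⟨C, hC⟩ := exists_ofReal_kernelB_le hκ
  refine ⟨C, fun f x hx θ hθ => ?_⟩
  let K : ℝ≥0∞ := C * ENNReal.ofReal (kernelSize κ (lift x) θ)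
  calc ∫⁻ y, ENNReal.ofReal |f y| * ENNReal.ofReal (kernelB κ x θ y) ∂measB κ
      ≤ ∫⁻ y, (⋃ ε, capB (signAct x ε) θ).indicator (fun y => ENNReal.ofReal |f y| * K) y
          ∂measB κ := by
        refine lintegral_mono_ae ((ae_mem_B κ).mono fun y hy => ?_)
        rw [indicator_mul_right]
        gcongr
        exact hC x hx y hy θ hθ
    _ = K * ∫⁻ y in ⋃ ε, capB (signAct x ε) θ, ENNReal.ofReal |f y| ∂measB κ := by
        rw [lintegral_indicator (.iUnion fun ε => measurableSet_capB _ _),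
          lintegral_mul_const' _ _ (by finiteness), mul_comm]
    _ ≤ K * ∑ ε, ∫⁻ y in capB (signAct x ε) θ, ENNReal.ofReal |f y| ∂measB κ := by
        gcongr
        exact (lintegral_iUnion_le _ _).trans_eq (tsum_fintype _)

theorem exists_mul_measB_capB_le_lintegral_kernelB (hκ : ∀ i, 0 ≤ κ i) :
    ∃ C : ℝ≥0, ∀ x ∈ B d, ∀ θ ∈ Ioc 0 Real.pi,
      ENNReal.ofReal (kernelSize κ (lift x) θ) * measB κ (capB x (θ / 4)) ≤
        C * ∫⁻ y, ENNReal.ofReal (kernelB κ x θ y) ∂measB κ := by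
  obtain ⟨C, hC⟩ := exists_le_ofReal_kernelB hκ
  refine ⟨C, fun x hx θ hθ => ?_⟩
  calc ENNReal.ofReal (kernelSize κ (lift x) θ) * measB κ (capB x (θ / 4))
      = ∫⁻ _ in capB x (θ / 4), ENNReal.ofReal (kernelSize κ (lift x) θ) ∂measB κ :=
        (setLIntegral_const _ _).symm
    _ ≤ ∫⁻ y in capB x (θ / 4), C * ENNReal.ofReal (kernelB κ x θ y) ∂measB κ :=
        setLIntegral_mono' (measurableSet_capB _ _) (hC x hx θ hθ)
    _ ≤ ∫⁻ y, C * ENNReal.ofReal (kernelB κ x θ y) ∂measB κ := setLIntegral_le_lintegral _ _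
    _ = C * ∫⁻ y, ENNReal.ofReal (kernelB κ x θ y) ∂measB κ :=
        lintegral_const_mul' _ _ ENNReal.coe_ne_top

theorem exists_calM_le_sum_hlM (hκ : ∀ i, 0 ≤ κ i) :
    ∃ C : ℝ≥0, ∀ f : EuclideanSpace ℝ (Fin d) → ℝ, ∀ x ∈ B d,
      calM κ f x ≤ C * ∑ ε : Fin d → ℤˣ, hlM κ f (signAct x ε) := by
  obtain ⟨C₁, hnum⟩ := exists_lintegral_mul_kernelB_le hκ
  obtain ⟨C₂, hden⟩ := exists_mul_measB_capB_le_lintegral_kernelB hκ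
  obtain ⟨C₃, hcap⟩ := exists_measB_capB_mul_le hκ (L := 4) (by norm_num)
  refine ⟨C₁ * C₃ * C₂, fun f x hx => iSup₂_le fun θ hθ => ENNReal.div_le_of_le_mul ?_⟩
  let K : ℝ≥0∞ := ENNReal.ofReal (kernelSize κ (lift x) θ)
  have hcap' : ∀ ε, measB κ (capB (signAct x ε) θ) ≤ C₃ * measB κ (capB x (θ / 4)) := fun ε => by
    have h := hcap x hx _ (signAct_mem_B hx ε) (abs_lift_signAct x ε) (θ / 4)
      ⟨by linarith [hθ.1], by linarith [hθ.1, hθ.2]⟩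
    rwa [mul_div_cancel₀ θ four_ne_zero] at h
  calc ∫⁻ y, ENNReal.ofReal |f y| * ENNReal.ofReal (kernelB κ x θ y) ∂measB κ
      ≤ C₁ * K * ∑ ε, ∫⁻ y in capB (signAct x ε) θ, ENNReal.ofReal |f y| ∂measB κ :=
        hnum f x hx θ hθ
    _ ≤ C₁ * K * ∑ ε, hlM κ f (signAct x ε) * (C₃ * measB κ (capB x (θ / 4))) := by
        gcongr with ε
        exact (lintegral_capB_le_hlM_mul hκ f (signAct_mem_B hx ε) hθ).trans
          (mul_le_mul_right (hcap' ε) _)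
    _ = C₁ * C₃ * (∑ ε, hlM κ f (signAct x ε)) * (K * measB κ (capB x (θ / 4))) := by
        rw [← Finset.sum_mul]
        ring
    _ ≤ C₁ * C₃ * (∑ ε, hlM κ f (signAct x ε)) *
          (C₂ * ∫⁻ y, ENNReal.ofReal (kernelB κ x θ y) ∂measB κ) :=
        mul_le_mul_right (hden x hx θ hθ) _
    _ = _ := by
        rw [ENNReal.coe_mul, ENNReal.coe_mul]
        ring

end Maximal

end BallMax

theorem mainTheorem10_general (d : ℕ) (κ : Fin (d + 1) → ℝ) (hκ : ∀ i, 0 ≤ κ i) :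
    (∃ c : ℝ≥0, ∀ f : EuclideanSpace ℝ (Fin d) → ℝ, ∀ x ∈ BallMax.B d,
      BallMax.calM κ f x ≤
        (c : ℝ≥0∞) * ∑ ε : Fin d → ℤˣ, BallMax.hlM κ f (BallMax.signAct x ε)) ∧
    (∃ C : ℝ≥0, ∀ x ∈ BallMax.B d, ∀ θ : ℝ, 0 < θ →
      0 < BallMax.measB κ (BallMax.capB x θ) ∧
      BallMax.measB κ (BallMax.capB x (2 * θ)) < ∞ ∧
      BallMax.measB κ (BallMax.capB x (2 * θ)) ≤
        (C : ℝ≥0∞) * BallMax.measB κ (BallMax.capB x θ)) := by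
  obtain ⟨C, hC⟩ := BallMax.exists_measB_capB_two_mul_le hκ
  exact ⟨BallMax.exists_calM_le_sum_hlM hκ, C, fun x hx θ hθ =>
    ⟨BallMax.measB_capB_pos hκ hx hθ, BallMax.measB_capB_lt_top hκ hx (2 * θ), hC x hx θ hθ⟩⟩

theorem mainTheorem10 (d : ℕ) (hd : 1 ≤ d) (κ : Fin (d + 1) → ℝ) (hκ : ∀ i, 0 ≤ κ i) :
    (∃ c : ℝ≥0, ∀ f : EuclideanSpace ℝ (Fin d) → ℝ, Integrable f (BallMax.measB κ) →
      ∀ x ∈ BallMax.B d,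
        BallMax.calM κ f x ≤
          (c : ℝ≥0∞) * ∑ ε : Fin d → ℤˣ, BallMax.hlM κ f (BallMax.signAct x ε)) ∧
    (∃ C : ℝ≥0, ∀ x ∈ BallMax.B d, ∀ θ : ℝ, 0 < θ →
      0 < BallMax.measB κ (BallMax.capB x θ) ∧
      BallMax.measB κ (BallMax.capB x (2 * θ)) < ∞ ∧
      BallMax.measB κ (BallMax.capB x (2 * θ)) ≤
        (C : ℝ≥0∞) * BallMax.measB κ (BallMax.capB x θ)) := by
  obtain ⟨⟨c, hc⟩, hdoubling⟩ := mainTheorem10_general d κ hκ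
  exact ⟨⟨c, fun f _ => hc f⟩, hdoubling⟩
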